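/- All groups are profinite and all homomorphisms are continuous; subgroups are closed; $\twoheadrightarrow$ denotes an epimorphism. Two epimorphisms $\eta\colon E\twoheadrightarrow G$, $\eta_1\colon E_1\twoheadrightarrow G$ are isomorphic, $\eta\cong_G\eta_1$, if $\eta=\eta_1\circ\varepsilon$ for an isomorphism $\varepsilon\colon E\to E_1$. An epimorphism is indecomposable if it is not an isomorphism and, whenever it is a composition of two epimorphisms, one of them is an isomorphism. An epimorphism $\tau\colon H\twoheadrightarrow G$ is fundamental if the intersection (taken inside $\operatorname{Ker}\tau$) of all maximal elements of the set of normal subgroups of $H$ properly contained in $\operatorname{Ker}\tau$ is trivial. Let $\Lambda_{\mathrm{na}}(G)$ be the isomorphism classes of indecomposable epimorphisms onto $G$ with non-abelian kernel, and $\Lambda_{\mathrm{ab}}(G)$ the isomorphism classes of finite simple $G$-modules. Let $\tau\colon H\twoheadrightarrow G$ be an epimorphism. For $\zeta\in\Lambda_{\mathrm{na}}(G)$ let $\operatorname{mult}_\zeta(\tau)$ be the cardinality of the set of normal subgroups $N\le\operatorname{Ker}\tau$ of $H$ such that $(H/N\twoheadrightarrow G)\cong_G\zeta$. For $A\in\Lambda_{\mathrm{ab}}(G)$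 let $N_A$ be the intersection (taken inside $\operatorname{Ker}\tau$) of all normal subgroups $N\le \operatorname{Ker}\tau$ of $H$ such that $\operatorname{Ker}(H/N\twoheadrightarrow G)\cong_G A$, let $B_A=\operatorname{Ker}(H/N_A\twoheadrightarrow G)$, let $f_A\in H^2(G,B_A)$ be the class of the extension $1\to B_A\to H/N_A\to G\to 1$, and let $S_A\colon \operatorname{Hom}_G(B_A,A)\to H^2(G,A)$, $\varphi\mapsto\varphi_*f_A$ (continuous homomorphisms, continuous cohomology), a linear map of vector spaces over the finite field $\operatorname{End}_G(A)$. Put $\operatorname{mult}_A(\tau)=\dim\operatorname{Ker}S_A$ (a cardinal) and $\operatorname{supp}_A(\tau)=\operatorname{Im}S_A$. Let $\tau\colon H\twoheadrightarrow G$ and $\tau'\colon H'\twoheadrightarrow G'$ be fundamental and let $\pi\colon G\twoheadrightarrow G'$ be an epimorphism. For an epimorphism $\zeta'\colon E'\twoheadrightarrow G'$ let $\operatorname{Inf}_\pi(\zeta')$ be the projection $G\times_{G'}E'\twoheadrightarrow G$; for a $G'$-module $A'$ let $\operatorname{Inf}_\pi(A')$ be $A'$ viewed as a $G$-module via $\pi$,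 and let $\operatorname{Inf}_{\pi,A'}\colon H^2(G',A')\to H^2(G,\operatorname{Inf}_\pi(A'))$ be the inflation map. Then there is an epimorphism $\theta\colon H\twoheadrightarrow H'$ such that $\tau'\circ\theta=\pi\circ\tau$ and the resulting square is semi-cartesian, i.e. $\theta(\operatorname{Ker}\tau)=\operatorname{Ker}\tau'$, if and only if the following three conditions hold: (a) $\operatorname{mult}_{\zeta'}(\tau')\le\operatorname{mult}_{\zeta}(\tau)$ for every $\zeta'\in\Lambda_{\mathrm{na}}(G')$ and $\zeta:=\operatorname{Inf}_\pi(\zeta')$; (b) $\operatorname{Inf}_{\pi,A'}(\operatorname{supp}_{A'}(\tau'))\subseteq\operatorname{supp}_A(\tau)$ for every $A'\in\Lambda_{\mathrm{ab}}(G')$ and $A:=\operatorname{Inf}_\pi(A')$; (c) $\nu_{\pi,A'}+\operatorname{mult}_{A'}(\tau')\le\operatorname{mult}_A(\tau)$ for every $A'\in\Lambda_{\mathrm{ab}}(G')$ and $A:=\operatorname{Inf}_\pi(A')$, where $\nu_{\pi,A'}$ is the nullity (dimension of the kernel) of the restriction of $\operatorname{Inf}_{\pi,A'}$ to $\operatorname{supp}_{A'}(\tau')$.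 -/

import Mathlib

/-!
All groups are profinite: compact totally disconnected topological groups (hence Hausdorff).
A continuous homomorphism of profinite groups is `H →ₜ* G`; an epimorphism (a cover of `G`) is a
surjective one.  `G`-modules are given by an action homomorphism `ρ : Representation ℤ G A`.
-/

universe u

namespace ProfiniteCover

section Covers

variable {H E G : Type u} [Group H] [TopologicalSpace H] [Group E] [TopologicalSpace E]
  [Group G] [TopologicalSpace G]

/-- Two covers of `G` are isomorphic over `G`. -/
def CoverIso (π : H →ₜ* G) (ζ : E →ₜ* G) : Prop :=
  ∃ e : H ≃ₜ* E, ∀ h, ζ (e h) = π h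

/-- Indecomposable epimorphisms.  (A bijective continuous homomorphism of profinite groups is an
isomorphism of profinite groups.) -/
structure IsIndecomposable (φ : H →ₜ* G) : Prop where
  surjective : Function.Surjective φ
  not_bijective : ¬ Function.Bijective φ
  bijective_or_bijective : ∀ (D : Type u) [Group D] [TopologicalSpace D] [IsTopologicalGroup D]
    [CompactSpace D] [TotallyDisconnectedSpace D] (ψ : H →ₜ* D) (ρ : D →ₜ* G),
    Function.Surjective ψ → Function.Surjective ρ → (∀ h, ρ (ψ h) = φ h) →
    Function.Bijective ψ ∨ Function.Bijective ρ

/-- The kernel of `φ` is not abelian. -/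
def HasNonabelianKernel (φ : H →ₜ* G) : Prop :=
  ∃ x ∈ φ.toMonoidHom.ker, ∃ y ∈ φ.toMonoidHom.ker, x * y ≠ y * x

/-- The (closed) normal subgroups of `H` that are maximal among those strictly contained
in `M`. -/
def maximalNormalIn (M : Subgroup H) : Set (Subgroup H) :=
  {N | Maximal (fun L : Subgroup H => L.Normal ∧ IsClosed (L : Set H) ∧ L < M) N}

/-- The fundament kernel: the intersection of the maximal ones among the normal subgroups of `H`
strictly contained in `Ker π`.  The intersection is taken inside `Ker π`, so that it is `Ker π`
if there are none, i.e. if `π` is injective. -/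
def fundamentKernel (π : H →ₜ* G) : Subgroup H :=
  π.toMonoidHom.ker ⊓ sInf (maximalNormalIn π.toMonoidHom.ker)

/-- An epimorphism is fundamental if its fundament kernel is trivial. -/
def IsFundamental (π : H →ₜ* G) : Prop := fundamentKernel π = ⊥

/-- The map `H/N → G` induced from `π`, for `N ≤ Ker π`. -/
def inducedMap (π : H →ₜ* G) (N : Subgroup H) [N.Normal] (hN : N ≤ π.toMonoidHom.ker) :
    H ⧸ N →ₜ* G where
  toMonoidHom := QuotientGroup.lift N π.toMonoidHom hN
  continuous_toFun := Continuous.quotient_lift π.continuous_toFun _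

/-- The set `𝒞_ζ` of (closed) normal subgroups `N ≤ Ker π` of `H` with `(H/N → G) ≅_G ζ`. -/
def coverQuotients (π : H →ₜ* G) (ζ : E →ₜ* G) : Set (Subgroup H) :=
  {N | ∃ (_ : N.Normal) (hN : N ≤ π.toMonoidHom.ker),
    IsClosed (N : Set H) ∧ CoverIso (inducedMap π N hN) ζ}

/-- The `ζ`-multiplicity of `π`. -/
noncomputable def coverMult (π : H →ₜ* G) (ζ : E →ₜ* G) : Cardinal.{u} :=
  Cardinal.mk (coverQuotients π ζ)

end Covers

section Squares

variable {H H' G G' : Type u} [Group H] [TopologicalSpace H] [Group H'] [TopologicalSpace H']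
  [Group G] [TopologicalSpace G] [Group G'] [TopologicalSpace G']

/-- The square with horizontal maps `θ : H → H'`, `π : G → G'` and vertical maps `τ : H → G`,
`τ' : H' → G'` commutes and `θ` maps `Ker τ` onto `Ker τ'`. -/
def IsSemiCartesian (θ : H →ₜ* H') (τ : H →ₜ* G) (τ' : H' →ₜ* G') (π : G →ₜ* G') : Prop :=
  (∀ h, τ' (θ h) = π (τ h)) ∧
    τ.toMonoidHom.ker.map θ.toMonoidHom = τ'.toMonoidHom.ker

/-- The underlying group of the fiber product `G ×_{G'} H'`. -/
def fiberProduct (π : G →ₜ* G') (ζ : H' →ₜ* G') : Subgroup (G × H') :=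
  (π.toMonoidHom.comp (MonoidHom.fst G H')).eqLocus (ζ.toMonoidHom.comp (MonoidHom.snd G H'))

/-- The inflation of a cover `ζ : H' → G'` along `π : G → G'`: the first projection
`G ×_{G'} H' → G`. -/
def inflCover (π : G →ₜ* G') (ζ : H' →ₜ* G') : fiberProduct π ζ →ₜ* G where
  toMonoidHom := (MonoidHom.fst G H').comp (fiberProduct π ζ).subtype
  continuous_toFun := continuous_fst.comp continuous_subtype_val

end Squares

section Modules

variable {G A : Type u} [Group G] [AddCommGroup A]

/-- `ρ` makes `A` a finite simple (discrete) module over the topological group `G`; in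
particular `G` acts continuously on `A`. -/
structure IsFiniteSimple [TopologicalSpace G] (ρ : Representation ℤ G A) : Prop where
  finite : Finite A
  continuous : ∀ a : A, IsLocallyConstant fun g => ρ g a
  nontrivial : Nontrivial A
  simple : ∀ B : AddSubgroup A, (∀ g, ∀ b ∈ B, ρ g b ∈ B) → B = ⊥ ∨ B = ⊤

/-- `End_G(A)`, the ring of additive endomorphisms of `A` that commute with the action
of `G`. -/
def EndRing (ρ : Representation ℤ G A) : Type u :=
  Subalgebra.centralizer ℤ (Set.range ρ)

instance (ρ : Representation ℤ G A) : Ring (EndRing ρ) :=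
  inferInstanceAs (Ring (Subalgebra.centralizer ℤ (Set.range ρ)))

/-- `End_G(A)` acts on `A` by application. -/
instance (ρ : Representation ℤ G A) : Module (EndRing ρ) A :=
  inferInstanceAs (Module (Subalgebra.centralizer ℤ (Set.range ρ)) A)

lemma endRing_comm {ρ : Representation ℤ G A} (α : EndRing ρ) (g : G) (a : A) :
    α • (ρ g a) = ρ g (α • a) := by
  have := (Subalgebra.mem_centralizer_iff ℤ).1 α.2 (ρ g) ⟨g, rfl⟩
  exact (LinearMap.congr_fun this a).symm

lemma isLocallyConstant_smul {X : Type*} [TopologicalSpace X] {ρ : Representation ℤ G A}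
    (α : EndRing ρ) {f : X → A} (hf : IsLocallyConstant f) : IsLocallyConstant (α • f) :=
  hf.comp (fun a => α • a)

end Modules

section Cohomology

variable {G A : Type u} [Group G] [TopologicalSpace G] [AddCommGroup A]

/-- Continuous non-homogeneous 2-cocycles of `G` with values in the discrete module `A`. -/
def cocycles₂ (ρ : Representation ℤ G A) : Submodule (EndRing ρ) (G × G → A) where
  carrier := {f | IsLocallyConstant f ∧
    ∀ x y z : G, ρ x (f (y, z)) - f (x * y, z) + f (x, y * z) - f (x, y) = 0}
  add_mem' := by
    rintro f g ⟨hf, hf'⟩ ⟨hg, hg'⟩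
    refine ⟨hf.add hg, fun x y z => ?_⟩
    have h := congrArg₂ (· + ·) (hf' x y z) (hg' x y z)
    simp only [add_zero] at h
    rw [← h]
    simp only [Pi.add_apply, map_add]
    abel
  zero_mem' := ⟨IsLocallyConstant.const 0, by simp⟩
  smul_mem' := by
    rintro α f ⟨hf, hf'⟩
    refine ⟨isLocallyConstant_smul α hf, fun x y z => ?_⟩
    have h := congrArg (fun a => α • a) (hf' x y z)
    simpa only [smul_sub, smul_add, smul_zero, endRing_comm, Pi.smul_apply] using h

/-- Coboundaries of continuous non-homogeneous 1-cochains. -/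
def coboundaries₂ (ρ : Representation ℤ G A) : Submodule (EndRing ρ) (G × G → A) where
  carrier := {f | ∃ c : G → A, IsLocallyConstant c ∧
    ∀ x y : G, f (x, y) = ρ x (c y) - c (x * y) + c x}
  add_mem' := by
    rintro f g ⟨c, hc, hf⟩ ⟨d, hd, hg⟩
    refine ⟨c + d, hc.add hd, fun x y => ?_⟩
    simp only [Pi.add_apply, map_add, hf, hg]
    abel
  zero_mem' := ⟨0, IsLocallyConstant.const 0, by simp⟩
  smul_mem' := by
    rintro α f ⟨c, hc, hf⟩
    refine ⟨α • c, isLocallyConstant_smul α hc, fun x y => ?_⟩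
    simp only [Pi.smul_apply, hf, smul_add, smul_sub, endRing_comm]

/-- `H²(G, A)`, continuous cohomology with values in the discrete module `A`, as a module
over `End_G(A)`.  (Coboundaries of continuous cochains are cocycles when `G` acts
continuously.) -/
abbrev H2 (ρ : Representation ℤ G A) : Type u :=
  cocycles₂ ρ ⧸ (coboundaries₂ ρ).submoduleOf (cocycles₂ ρ)

end Cohomology

section Inflation

variable {G G' A : Type u} [Group G] [TopologicalSpace G] [Group G'] [TopologicalSpace G']
  [AddCommGroup A]

/-- `Inf_π(A)`: a `G'`-module viewed as a `G`-module via `π : G → G'`. -/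
abbrev inflModule (π : G →ₜ* G') (ρ : Representation ℤ G' A) : Representation ℤ G A :=
  MonoidHom.comp ρ π.toMonoidHom

/-- The inclusion of `End_{G'}(A)` in `End_G(Inf_π(A))`; it is the identity if `π` is
surjective. -/
def endIncl (π : G →ₜ* G') (ρ : Representation ℤ G' A) :
    EndRing ρ →+* EndRing (inflModule π ρ) :=
  (Subalgebra.inclusion (Subalgebra.centralizer_le ℤ _ _ (by
    rintro _ ⟨g, rfl⟩; exact ⟨π g, rfl⟩))).toRingHom

/-- Inflation of cocycles along `π`. -/
def inflCocycles (π : G →ₜ* G') (ρ : Representation ℤ G' A) :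
    cocycles₂ ρ →ₛₗ[endIncl π ρ] cocycles₂ (inflModule π ρ) where
  toFun f := ⟨fun p => f.1 (π p.1, π p.2),
    f.2.1.comp_continuous (by have := π.continuous_toFun; fun_prop),
    fun x y z => by simpa using f.2.2 (π x) (π y) (π z)⟩
  map_add' _ _ := rfl
  map_smul' _ _ := rfl

/-- The inflation `H²(G', A) → H²(G, Inf_π(A))`. -/
noncomputable def inflH2 (π : G →ₜ* G') (ρ : Representation ℤ G' A) :
    H2 ρ →ₛₗ[endIncl π ρ] H2 (inflModule π ρ) :=
  Submodule.mapQ _ _ (inflCocycles π ρ) (by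
    rintro f ⟨c, hc, hf⟩
    exact ⟨fun x => c (π x), hc.comp_continuous π.continuous_toFun,
      fun x y => by
        have h := hf (π x) (π y)
        rw [← map_mul π] at h
        exact h⟩)

end Inflation

section Sections

open Set

theorem exists_section_aux {H G : Type u} [Group H] [TopologicalSpace H] [IsTopologicalGroup H]
    [CompactSpace H] [TotallyDisconnectedSpace H] [Group G] [TopologicalSpace G]
    [T2Space G] (π : H →ₜ* G) (hπ : Function.Surjective π) :
    ∃ T : Set H, IsClosed T ∧ (∀ g, ∃ t ∈ T, π t = g) ∧ ∀ x ∈ T, ∀ y ∈ T, π x = π y → x = y := by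
  have hπc : Continuous π := π.continuous_toFun
  have : CompactSpace G := hπ.compactSpace hπc
  let S : Set (Subgroup H × Set H)ᵒᵈ := {p | IsClosed ((OrderDual.ofDual p).1 : Set H) ∧
    IsClosed (OrderDual.ofDual p).2 ∧
    (∀ l ∈ (OrderDual.ofDual p).1, π l = 1) ∧
    (∀ t ∈ (OrderDual.ofDual p).2, ∀ l ∈ (OrderDual.ofDual p).1, t * l ∈ (OrderDual.ofDual p).2) ∧
    (∀ g, ∃ t ∈ (OrderDual.ofDual p).2, π t = g) ∧
    ∀ x ∈ (OrderDual.ofDual p).2, ∀ y ∈ (OrderDual.ofDual p).2, π x = π y →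
      x⁻¹ * y ∈ (OrderDual.ofDual p).1}
  have hS0 : OrderDual.toDual (π.toMonoidHom.ker, (Set.univ : Set H)) ∈ S := by
    refine ⟨?_, isClosed_univ, fun l hl => hl, fun _ _ _ _ => mem_univ _,
      fun g => ⟨_, mem_univ _, (hπ g).choose_spec⟩, fun x _ y _ h => ?_⟩
    · exact isClosed_singleton.preimage hπc
    · change π (x⁻¹ * y) = 1
      simp [h]
  obtain ⟨m, -, hm⟩ := zorn_le_nonempty₀ S (fun c hcS hc y hy => by
    refine ⟨OrderDual.toDual (⨅ p : c, (OrderDual.ofDual p.1).1, ⋂ p : c, (OrderDual.ofDual p.1).2),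
      ⟨?_, ?_, ?_, ?_, ?_, ?_⟩, ?_⟩
    · simp only [OrderDual.ofDual_toDual, Subgroup.coe_iInf]
      exact isClosed_iInter fun p => (hcS p.2).1
    · exact isClosed_iInter fun p => (hcS p.2).2.1
    · intro l hl
      exact (hcS hy).2.2.1 l (Subgroup.mem_iInf.1 hl ⟨y, hy⟩)
    · intro t ht l hl
      exact mem_iInter.2 fun p => (hcS p.2).2.2.2.1 t (mem_iInter.1 ht p) l
        (Subgroup.mem_iInf.1 hl p)
    · intro g
      have : Nonempty c := ⟨⟨y, hy⟩⟩
      have hcl : ∀ p : c, IsClosed ((OrderDual.ofDual p.1).2 ∩ π ⁻¹' {g}) := fun p =>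
        (hcS p.2).2.1.inter (isClosed_singleton.preimage hπc)
      obtain ⟨t, ht⟩ := IsCompact.nonempty_iInter_of_directed_nonempty_isCompact_isClosed
        (fun p : c => (OrderDual.ofDual p.1).2 ∩ π ⁻¹' {g})
        (fun p q => by
          rcases hc.total p.2 q.2 with h | h
          · exact ⟨q, inter_subset_inter_left _ h.2, subset_rfl⟩
          · exact ⟨p, subset_rfl, inter_subset_inter_left _ h.2⟩)
        (fun p => by
          obtain ⟨t, h1, h2⟩ := (hcS p.2).2.2.2.2.1 g
          exact ⟨t, h1, h2⟩)
        (fun p => (hcl p).isCompact) hcl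
      exact ⟨t, mem_iInter.2 fun p => (mem_iInter.1 ht p).1, (mem_iInter.1 ht ⟨y, hy⟩).2⟩
    · intro a ha b hb hab
      exact Subgroup.mem_iInf.2 fun p => (hcS p.2).2.2.2.2.2 a (mem_iInter.1 ha p) b
        (mem_iInter.1 hb p) hab
    · intro z hz
      exact ⟨iInf_le (fun p : c => (OrderDual.ofDual p.1).1) ⟨z, hz⟩,
        iInter_subset (fun p : c => (OrderDual.ofDual p.1).2) ⟨z, hz⟩⟩) _ hS0
  obtain ⟨⟨hL, hT, hLk, hTL, hsurj, hinj⟩, hmax⟩ := hm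
  set L := (OrderDual.ofDual m).1
  set T := (OrderDual.ofDual m).2
  refine ⟨T, hT, hsurj, fun x hx y hy hxy => ?_⟩
  suffices hbot : ∀ l ∈ L, l = 1 from (inv_mul_eq_one.1 (hbot _ (hinj x hx y hy hxy)))
  by_contra! hne
  obtain ⟨l, hlL, hl1⟩ := hne
  obtain ⟨U, hU⟩ := ProfiniteGrp.exist_openNormalSubgroup_sub_open_nhds_of_one (G := H)
    (isOpen_compl_singleton (x := l)) (by simpa using hl1.symm)
  have hlU : l ∉ U := fun h => hU h rfl
  have hUo : IsOpen (U : Set H) := U.isOpen'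
  -- the piece of `T` over which `x` lies in the coset `t U`
  let P : T → Set H := fun t => T ∩ {x | t.1⁻¹ * x ∈ U}
  have hPo : ∀ t : T, IsOpen (π '' P t) := by
    intro t
    have : (π '' P t)ᶜ = π '' (T ∩ ⋂ l : L, {x | t.1⁻¹ * (x * l.1) ∈ U}ᶜ) := by
      ext g
      constructor
      · intro hg
        obtain ⟨x, hx, rfl⟩ := hsurj g
        refine ⟨x, ⟨hx, mem_iInter.2 fun k hk => hg ⟨x * k, ⟨hTL _ hx _ k.2, hk⟩, ?_⟩⟩, rfl⟩
        simp [hLk k k.2]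
      · rintro ⟨x, ⟨hx, hx'⟩, rfl⟩ ⟨z, ⟨hz, hz'⟩, hzx⟩
        refine mem_iInter.1 hx' ⟨x⁻¹ * z, hinj x hx z hz hzx.symm⟩ ?_
        simpa using hz'
    rw [← isClosed_compl_iff, this]
    refine (IsClosed.isCompact (hT.inter (isClosed_iInter fun k => ?_))).image hπc |>.isClosed
    exact (hUo.preimage (by fun_prop : Continuous fun x : H => t.1⁻¹ * (x * k.1))).isClosed_compl
  have hUc : IsClosed (U : Set H) := Subgroup.isClosed_of_isOpen U.toSubgroup hUo
  have hPcl : ∀ t : T, IsClosed (P t) := fun t =>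
    hT.inter (hUc.preimage (by fun_prop : Continuous fun x : H => t.1⁻¹ * x))
  have hPc : ∀ t : T, IsClosed (π '' P t) := fun t => ((hPcl t).isCompact.image hπc).isClosed
  obtain ⟨F, hF⟩ := isCompact_univ.elim_finite_subcover (fun t : T => π '' P t) hPo (by
    intro g _
    obtain ⟨x, hx, rfl⟩ := hsurj g
    exact mem_iUnion.2 ⟨⟨x, hx⟩, x, ⟨hx, by simp⟩, rfl⟩)
  let e := F.equivFin.symm
  let f : Fin F.card → Set G := fun i => π '' P (e i)
  have hdc : ∀ i, IsClosed (disjointed f i) := by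
    intro i
    rw [disjointed_eq_inter_compl]
    exact (hPc _).inter (isClosed_biInter fun j _ => (hPo _).isClosed_compl)
  have hdU : ⋃ i, disjointed f i = univ := by
    rw [iUnion_disjointed]
    refine eq_univ_of_forall fun g => ?_
    obtain ⟨t, ht, hg⟩ := mem_iUnion₂.1 (hF (mem_univ g))
    refine mem_iUnion.2 ⟨F.equivFin ⟨t, ht⟩, ?_⟩
    simpa [f, e] using hg
  have hdd : ∀ i j g, g ∈ disjointed f i → g ∈ disjointed f j → i = j := by
    intro i j g hi hj
    by_contra hij
    exact Set.disjoint_left.1 (disjoint_disjointed f hij) hi hj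
  let T' : Set H := ⋃ i, P (e i) ∩ π ⁻¹' disjointed f i
  have hmem : OrderDual.toDual (L ⊓ U.toSubgroup, T') ∈ S := by
    refine ⟨hL.inter hUc, ?_, fun k hk => hLk k hk.1, ?_, ?_, ?_⟩
    · exact isClosed_iUnion_of_finite fun i => (hPcl _).inter ((hdc i).preimage hπc)
    · intro t ht k hk
      obtain ⟨i, ⟨ht1, ht2⟩, ht3⟩ := mem_iUnion.1 ht
      refine mem_iUnion.2 ⟨i, ⟨hTL _ ht1 _ hk.1, ?_⟩, ?_⟩
      · have := U.toSubgroup.mul_mem ht2 hk.2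
        rwa [mul_assoc] at this
      · simpa [hLk k hk.1] using ht3
    · intro g
      obtain ⟨i, hi⟩ := mem_iUnion.1 (hdU ▸ mem_univ g)
      obtain ⟨x, hx, rfl⟩ := disjointed_subset f i hi
      exact ⟨x, mem_iUnion.2 ⟨i, hx, hi⟩, rfl⟩
    · intro a ha b hb hab
      obtain ⟨i, ⟨ha1, ha2⟩, ha3⟩ := mem_iUnion.1 ha
      obtain ⟨j, ⟨hb1, hb2⟩, hb3⟩ := mem_iUnion.1 hb
      obtain rfl := hdd i j (π a) ha3 (by simpa [hab] using hb3)
      refine ⟨hinj a ha1 b hb1 hab, ?_⟩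
      have := U.mul_mem (U.inv_mem ha2) hb2
      simpa [mul_assoc] using this
  have hle := hmax hmem ⟨inf_le_left, iUnion_subset fun i => fun x hx => hx.1.1⟩
  exact hlU (hle.1 hlL).2

/-- An epimorphism of profinite groups has a continuous section. -/
theorem exists_section {H G : Type u} [Group H] [TopologicalSpace H] [IsTopologicalGroup H]
    [CompactSpace H] [TotallyDisconnectedSpace H] [Group G] [TopologicalSpace G]
    [T2Space G] (π : H →ₜ* G) (hπ : Function.Surjective π) :
    ∃ s : C(G, H), ∀ g, π (s g) = g := by
  obtain ⟨T, hT, hsurj, hinj⟩ := exists_section_aux π hπ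
  have : CompactSpace T := isCompact_iff_compactSpace.1 hT.isCompact
  have hc : Continuous (fun t : T => π t.1) := π.continuous_toFun.comp continuous_subtype_val
  let e : T ≃ G := Equiv.ofBijective (fun t : T => π t.1)
    ⟨fun x y h => Subtype.ext (hinj _ x.2 _ y.2 h), fun g => by
      obtain ⟨t, ht, h⟩ := hsurj g
      exact ⟨⟨t, ht⟩, h⟩⟩
  exact ⟨⟨fun g => (e.symm g).1, continuous_subtype_val.comp
    (hc.continuous_symm_of_equiv_compact_to_t2 (f := e))⟩, fun g => e.apply_symm_apply g⟩

end Sections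

section Extensions

variable {E G A : Type u} [Group E] [TopologicalSpace E] [Group G] [TopologicalSpace G]
  [AddCommGroup A]

/-- `K^* = Hom_G(K, A)` for the kernel `K` of a cover `η : E → G`: the continuous homomorphisms
`φ : K → A` (`A` discrete) with `φ(e k e⁻¹) = η(e) φ(k)`, i.e. which are `G`-equivariant for the
action of `G` induced by conjugation in `E`.  It is a module over `End_G(A)`. -/
def kerDual (η : E →ₜ* G) (ρ : Representation ℤ G A) :
    Submodule (EndRing ρ) (η.toMonoidHom.ker → A) where
  carrier := {φ | IsLocallyConstant φ ∧ (∀ x y, φ (x * y) = φ x + φ y) ∧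
    ∀ (e : E) (x : η.toMonoidHom.ker), φ (MulAut.conjNormal e x) = ρ (η e) (φ x)}
  add_mem' := by
    rintro φ ψ ⟨h1, h2, h3⟩ ⟨k1, k2, k3⟩
    refine ⟨h1.add k1, fun x y => ?_, fun e x => ?_⟩
    · simp only [Pi.add_apply, h2, k2]
      abel
    · simp only [Pi.add_apply, h3, k3, map_add]
  zero_mem' := ⟨IsLocallyConstant.const 0, fun _ _ => (add_zero 0).symm, fun _ _ => (map_zero _).symm⟩
  smul_mem' := by
    rintro α φ ⟨h1, h2, h3⟩
    refine ⟨isLocallyConstant_smul α h1, fun x y => ?_, fun e x => ?_⟩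
    · simp only [Pi.smul_apply, h2, smul_add]
    · simp only [Pi.smul_apply, h3, endRing_comm]

/-- The 2-cocycle `(x, y) ↦ s(x) s(y) s(xy)⁻¹` with values in `Ker η` that a section `s` of `η`
defines; for continuous `s` its class is the element of `H²(G, Ker η)` that corresponds to the
extension `η` of `G` by `Ker η`. -/
def factorSet (η : E →ₜ* G) (s : G → E) (hs : ∀ g, η (s g) = g) (p : G × G) :
    η.toMonoidHom.ker :=
  ⟨s p.1 * s p.2 * (s (p.1 * p.2))⁻¹, by
    change η (s p.1 * s p.2 * (s (p.1 * p.2))⁻¹) = 1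
    simp [hs]⟩

variable [IsTopologicalGroup E] [IsTopologicalGroup G]

lemma comp_factorSet_mem (η : E →ₜ* G) (s : C(G, E)) (hs : ∀ g, η (s g) = g)
    (ρ : Representation ℤ G A) (φ : kerDual η ρ) :
    (fun p => φ.1 (factorSet η s hs p)) ∈ cocycles₂ ρ := by
  obtain ⟨φ, h1, h2, h3⟩ := φ
  refine ⟨h1.comp_continuous ?_, fun x y z => ?_⟩
  · have := s.continuous
    unfold factorSet
    fun_prop
  · have key : MulAut.conjNormal (s x) (factorSet η s hs (y, z)) * factorSet η s hs (x, y * z) =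
        factorSet η s hs (x, y) * factorSet η s hs (x * y, z) := by
      apply Subtype.ext
      simp only [Subgroup.coe_mul, MulAut.conjNormal_apply, factorSet]
      group
    have h := congrArg φ key
    rw [h2, h2, h3, hs] at h
    change ρ x (φ _) - φ _ + φ _ - φ _ = 0
    have h' := sub_eq_zero.2 h
    rw [← h']
    abel

/-- The linear map `φ ↦ φ ∘ f` from `K^*` to cocycles, where `f` is the cocycle with values in
`K = Ker η` defined by the continuous section `s` of `η`. -/
def cocycleMap (η : E →ₜ* G) (s : C(G, E)) (hs : ∀ g, η (s g) = g)
    (ρ : Representation ℤ G A) : kerDual η ρ →ₗ[EndRing ρ] cocycles₂ ρ where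
  toFun φ := ⟨fun p => φ.1 (factorSet η s hs p), comp_factorSet_mem η s hs ρ φ⟩
  map_add' _ _ := rfl
  map_smul' _ _ := rfl

/-- For a cover `η` of `G` with kernel `K` and class `f ∈ H²(G, K)`, the linear map
`S : K^* → H²(G, A)`, `φ ↦ φ_* f`.  The class of `φ ∘ f` does not depend on the continuous
section of `η` by which `f` is represented (`extensionMap_apply`). -/
noncomputable def extensionMap (η : E →ₜ* G) (hη : ∃ s : C(G, E), ∀ g, η (s g) = g)
    (ρ : Representation ℤ G A) : kerDual η ρ →ₗ[EndRing ρ] H2 ρ :=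
  (Submodule.mkQ _).comp (cocycleMap η hη.choose hη.choose_spec ρ)

/-- Every continuous section of `η` computes `extensionMap`. -/
lemma extensionMap_apply (η : E →ₜ* G) (s : C(G, E)) (hs : ∀ g, η (s g) = g)
    (ρ : Representation ℤ G A) (φ : kerDual η ρ) :
    extensionMap η ⟨s, hs⟩ ρ φ = Submodule.Quotient.mk (cocycleMap η s hs ρ φ) := by
  have hη : ∃ s : C(G, E), ∀ g, η (s g) = g := ⟨s, hs⟩
  change Submodule.Quotient.mk (cocycleMap η hη.choose hη.choose_spec ρ φ) = _
  generalize hη.choose = t, hη.choose_spec = ht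
  rw [Submodule.Quotient.eq]
  obtain ⟨φ, h1, h2, h3⟩ := φ
  let c : G → η.toMonoidHom.ker := fun g => ⟨t g * (s g)⁻¹, by
    change η (t g * (s g)⁻¹) = 1
    simp [hs, ht]⟩
  refine ⟨fun g => φ (c g), h1.comp_continuous ?_, fun x y => ?_⟩
  · have := s.continuous
    have := t.continuous
    fun_prop
  · have key : factorSet η t ht (x, y) * c (x * y) =
        c x * (MulAut.conjNormal (s x) (c y) * factorSet η s hs (x, y)) := by
      apply Subtype.ext
      simp only [Subgroup.coe_mul, MulAut.conjNormal_apply, factorSet, c]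
      group
    have h := congrArg φ key
    rw [h2, h2, h2, h3, hs] at h
    change φ (factorSet η t ht (x, y)) - φ (factorSet η s hs (x, y)) = _
    rw [eq_sub_of_add_eq h]
    abel

/-- The kernel of `η` is isomorphic to `A` as a `G`-module, where `G` acts on the kernel via
conjugation in `E`. -/
def KerIsoModule (η : E →ₜ* G) (ρ : Representation ℤ G A) : Prop :=
  ∃ e : η.toMonoidHom.ker ≃* Multiplicative A, ∀ (x : E) (k : η.toMonoidHom.ker),
    (e (MulAut.conjNormal x k)).toAdd = ρ (η x) (e k).toAdd

end Extensions

section Isotypic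

variable {H G A : Type u} [Group H] [TopologicalSpace H] [Group G] [TopologicalSpace G]
  [AddCommGroup A]

/-- The set `𝒞_A` of (closed) normal subgroups `N ≤ Ker π` of `H` such that
`Ker (H/N → G) ≅_G A`. -/
def moduleQuotients (π : H →ₜ* G) (ρ : Representation ℤ G A) : Set (Subgroup H) :=
  {N | ∃ (_ : N.Normal) (hN : N ≤ π.toMonoidHom.ker),
    IsClosed (N : Set H) ∧ KerIsoModule (inducedMap π N hN) ρ}

/-- `N_A`, the intersection of `𝒞_A`, taken inside `Ker π` (so that it is `Ker π` if `𝒞_A` is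
empty). -/
def isotypicKernel (π : H →ₜ* G) (ρ : Representation ℤ G A) : Subgroup H :=
  π.toMonoidHom.ker ⊓ sInf (moduleQuotients π ρ)

instance (π : H →ₜ* G) (ρ : Representation ℤ G A) : (isotypicKernel π ρ).Normal := by
  have : (sInf (moduleQuotients π ρ)).Normal :=
    ⟨fun n hn g => Subgroup.mem_sInf.2 fun N hN =>
      hN.1.conj_mem n (Subgroup.mem_sInf.1 hn N hN) g⟩
  exact Subgroup.normal_inf_normal _ _

/-- `H_A = H/N_A`. -/
abbrev IsotypicQuotient (π : H →ₜ* G) (ρ : Representation ℤ G A) : Type u :=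
  H ⧸ isotypicKernel π ρ

/-- The induced map `H_A → G`; its kernel is `B_A`. -/
def isotypicMap (π : H →ₜ* G) (ρ : Representation ℤ G A) : IsotypicQuotient π ρ →ₜ* G :=
  inducedMap π (isotypicKernel π ρ) inf_le_left

variable [IsTopologicalGroup H] [CompactSpace H] [TotallyDisconnectedSpace H]
  [IsTopologicalGroup G] [TotallyDisconnectedSpace G]

lemma isotypicMap_section (π : H →ₜ* G) (hπ : Function.Surjective π)
    (ρ : Representation ℤ G A) :
    ∃ s : C(G, IsotypicQuotient π ρ), ∀ g, isotypicMap π ρ (s g) = g := by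
  obtain ⟨s, hs⟩ := exists_section π hπ
  exact ⟨⟨fun g => (s g : IsotypicQuotient π ρ), continuous_quotient_mk'.comp s.continuous⟩, hs⟩

/-- The map `S_A : B_A^* → H²(G, A)` of the extension `1 → B_A → H_A → G → 1`. -/
noncomputable def isotypicS (π : H →ₜ* G) (hπ : Function.Surjective π)
    (ρ : Representation ℤ G A) : kerDual (isotypicMap π ρ) ρ →ₗ[EndRing ρ] H2 ρ :=
  extensionMap (isotypicMap π ρ) (isotypicMap_section π hπ ρ) ρ

/-- The `A`-multiplicity `dim Ker S_A` of `π`. -/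
noncomputable def moduleMult (π : H →ₜ* G) (hπ : Function.Surjective π)
    (ρ : Representation ℤ G A) : Cardinal.{u} :=
  Module.rank (EndRing ρ) (LinearMap.ker (isotypicS π hπ ρ))

/-- The `A`-support `Img S_A` of `π`. -/
noncomputable def moduleSupp (π : H →ₜ* G) (hπ : Function.Surjective π)
    (ρ : Representation ℤ G A) : Submodule (EndRing ρ) (H2 ρ) :=
  LinearMap.range (isotypicS π hπ ρ)

end Isotypic

section Nullity

variable {H' G G' A : Type u} [Group H'] [TopologicalSpace H'] [IsTopologicalGroup H']
  [CompactSpace H'] [TotallyDisconnectedSpace H'] [Group G] [TopologicalSpace G]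
  [Group G'] [TopologicalSpace G'] [IsTopologicalGroup G'] [TotallyDisconnectedSpace G']
  [AddCommGroup A]

/-- The nullity of the restriction of `Inf_{π,A}` to the `A`-support of `τ'`. -/
noncomputable def inflNullity (π : G →ₜ* G') (τ' : H' →ₜ* G') (hτ' : Function.Surjective τ')
    (ρ : Representation ℤ G' A) : Cardinal.{u} :=
  Module.rank (EndRing ρ)
    (LinearMap.ker ((inflH2 π ρ).domRestrict (moduleSupp τ' hτ' ρ)))

end Nullity

end ProfiniteCover

open ProfiniteCover

universe v

set_option linter.unusedSectionVars false

/-! Since `τ'` is fundamental, `Ker τ'` is detected by the maximal closed normal subgroups of `H'`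
strictly inside it. Those with non-abelian quotient correspond to indecomposable covers of `G'`.
Those with abelian quotient are the kernels of nonzero equivariant maps `Ker τ' → A`, `A` finite
simple (`exists_dualKernel_eq`). Take all of the first kind, and for each isomorphism class of `A`
the kernels of a basis of `Hom_{G'}(Ker τ', A)` over the division ring `End(A)`. This family meets
trivially in `Ker τ'`, and it is independent (`independentIn_sumElim`): every system of cosets has a
common representative. So `Ker τ'` behaves like the product of its simple quotients.

Necessity: `θ` maps `Ker τ` onto `Ker τ'`, so quotients and equivariant homomorphisms of `Ker τ'`
pull back injectively to `Ker τ`. The maps `S`, which may be computed on `Hom_G(Ker τ, A)` without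
passing to `H/N_A` (`isotypicS_eq`), satisfy `S(φ ∘ θ) = Inf (S φ)` (`extensionMap_kerMapDual`).
This gives (b), and also (c), because `ν + mult` is the nullity of `Inf ∘ S`
(`inflNullity_add_moduleMult`).

Sufficiency: (a) assigns to each non-abelian `N` an `M` in `Ker τ` and a homomorphism `H → H'/N`
over `π`, injectively in `N` (`exists_chiefLifts`). By (b) and (c), linear algebra gives an
injective semilinear `l` from `Hom_{G'}(Ker τ', A)` to `Hom_G(Ker τ, Inf A)` with `S ∘ l = Inf ∘ S`
(`exists_injective_kerDual`). Equality of the classes of `l φ` and `φ` makes `l φ - φ` extend to a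
crossed homomorphism on `H ×_{G'} H'`, whose zero set is a closed relation between `H` and `H'`
(`exists_relation_of_kerDual`). The intersection of all these relations is the graph of the required
`θ` (`exists_semiCartesian_of_relations`): independence on the `H'` side makes it defined
everywhere, fundamentality makes it single-valued, and independence on the `H` side makes it map
`Ker τ` onto `Ker τ'`. -/

namespace ProfiniteCover

open scoped commutatorElement

/-! ### Independent families of maximal normal subgroups. -/

section Independence

variable {H : Type u} [Group H]

/-- The subgroups `N i` of `M`, for `i` in the finite set `F`, are independent: every system of
cosets has a common representative. -/
def IndependentIn {ι : Type v} (M : Subgroup H) (N : ι → Subgroup H) (F : Finset ι) : Prop :=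
  ∀ x : ι → H, (∀ i, x i ∈ M) → ∃ k ∈ M, ∀ i ∈ F, (x i)⁻¹ * k ∈ N i

lemma independentIn_empty {ι : Type v} (M : Subgroup H) (N : ι → Subgroup H) :
    IndependentIn M N ∅ :=
  fun _ _ => ⟨1, M.one_mem, by simp⟩

/-- A representative `k` for the old cosets may be multiplied by any `d` in the intersection of the
old subgroups without spoiling it. As that intersection and `N j` generate `M`, a suitable `d` moves
`k` into the coset of `x j`. -/
lemma IndependentIn.insert_of_sup_eq {ι : Type v} [DecidableEq ι] {M : Subgroup H} {N : ι → Subgroup H}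
    {F : Finset ι} (hF : IndependentIn M N F) {j : ι} [(N j).Normal]
    (hj : (M ⊓ ⨅ i ∈ F, N i) ⊔ N j = M) : IndependentIn M N (Insert.insert j F) := by
  intro x hx
  obtain ⟨k, hk, hkF⟩ := hF x hx
  have hm : k⁻¹ * x j ∈ (M ⊓ ⨅ i ∈ F, N i) ⊔ N j := by
    rw [hj]; exact M.mul_mem (M.inv_mem hk) (hx j)
  obtain ⟨d, hd, n, hn, hdn⟩ := Subgroup.mem_sup_of_normal_right.1 hm
  refine ⟨k * d, M.mul_mem hk hd.1, fun i hi => ?_⟩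
  rcases Finset.mem_insert.1 hi with rfl | hi
  · have : (x i)⁻¹ * (k * d) = n⁻¹ := by
      have : x i = k * (d * n) := by rw [hdn]; group
      rw [this]; group
    rw [this]; exact (N i).inv_mem hn
  · rw [← mul_assoc]
    exact (N i).mul_mem (hkF i hi) (Subgroup.mem_iInf.1 (Subgroup.mem_iInf.1 hd.2 i) hi)

/-- If two normal subgroups cover `M` modulo `Z` and meet in `Z`, then `M / Z` is abelian. -/
lemma commutator_mem_of_inf_le {M X Y Z : Subgroup H} [X.Normal] [Y.Normal] [Z.Normal]
    (h : X ⊓ Y ≤ Z) (hX : X ⊔ Z = M) (hY : Y ⊔ Z = M) {a b : H} (ha : a ∈ M) (hb : b ∈ M) :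
    ⁅a, b⁆ ∈ Z := by
  rw [← hX] at ha
  rw [← hY] at hb
  have hmap : ∀ W : Subgroup H, ∀ w ∈ W ⊔ Z, (QuotientGroup.mk' Z) w ∈ W.map (QuotientGroup.mk' Z) := by
    intro W w hw
    have := Subgroup.mem_map_of_mem (QuotientGroup.mk' Z) hw
    rwa [Subgroup.map_sup, QuotientGroup.map_mk'_self, sup_bot_eq] at this
  -- Modulo `Z`, `a` comes from `X` and `b` from `Y`, so their commutator comes from `[X, Y] ≤ X ⊓ Y
  -- ≤ Z`.
  have h1 := Subgroup.commutator_mem_commutator (hmap X a ha) (hmap Y b hb)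
  rw [← Subgroup.map_commutator] at h1
  have h2 : Subgroup.map (QuotientGroup.mk' Z) ⁅X, Y⁆ ≤ ⊥ := by
    rw [← QuotientGroup.map_mk'_self Z]
    exact Subgroup.map_mono ((Subgroup.commutator_le_inf X Y).trans h)
  have h3 := Subgroup.mem_bot.1 (h2 h1)
  rw [← map_commutatorElement] at h3
  exact (QuotientGroup.eq_one_iff _).1 h3

section Maximal

variable [TopologicalSpace H]

/-- `N` is maximal among the closed normal subgroups strictly contained in `M`. -/
abbrev IsMaximalNormalIn (M N : Subgroup H) : Prop := N ∈ maximalNormalIn M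

lemma IsMaximalNormalIn.normal {M N : Subgroup H} (h : IsMaximalNormalIn M N) : N.Normal := h.1.1

lemma IsMaximalNormalIn.isClosed {M N : Subgroup H} (h : IsMaximalNormalIn M N) :
    IsClosed (N : Set H) := h.1.2.1

lemma IsMaximalNormalIn.lt {M N : Subgroup H} (h : IsMaximalNormalIn M N) : N < M := h.1.2.2

lemma IsMaximalNormalIn.eq_of_le {M N L : Subgroup H} (h : IsMaximalNormalIn M N)
    (hL : IsMaximalNormalIn M L) (hle : N ≤ L) : N = L :=
  le_antisymm hle (h.2 hL.1 hle)

variable [IsTopologicalGroup H] [CompactSpace H] [TotallyDisconnectedSpace H]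

lemma isClosed_sup {D N : Subgroup H} [N.Normal] (hD : IsClosed (D : Set H))
    (hN : IsClosed (N : Set H)) : IsClosed ((D ⊔ N : Subgroup H) : Set H) := by
  rw [Subgroup.mul_normal]
  exact (hD.isCompact.mul hN.isCompact).isClosed

/-- Otherwise `D ⊔ N`, closed by compactness, would be an admissible subgroup above `N`, and
maximality would force `D ≤ N`. -/
lemma IsMaximalNormalIn.sup_eq {M N D : Subgroup H} (h : IsMaximalNormalIn M N) [D.Normal]
    (hD : IsClosed (D : Set H)) (hDM : D ≤ M) (hDN : ¬ D ≤ N) : D ⊔ N = M := by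
  have := h.normal
  by_contra hne
  have hlt : D ⊔ N < M := lt_of_le_of_ne (sup_le hDM h.lt.le) hne
  exact hDN (le_sup_left.trans
    (h.2 ⟨inferInstance, isClosed_sup hD h.isClosed, hlt⟩ le_sup_right))

lemma isClosed_inf_iInf {ι : Type v} {M : Subgroup H} (hMc : IsClosed (M : Set H))
    {N : ι → Subgroup H} (hN : ∀ i, IsMaximalNormalIn M (N i)) (F : Finset ι) :
    IsClosed ((M ⊓ ⨅ i ∈ F, N i : Subgroup H) : Set H) := by
  simp only [Subgroup.coe_inf, Subgroup.coe_iInf]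
  exact hMc.inter (isClosed_biInter fun i _ => (hN i).isClosed)

lemma normal_inf_iInf {ι : Type v} {M : Subgroup H} [M.Normal]
    {N : ι → Subgroup H} (hN : ∀ i, IsMaximalNormalIn M (N i)) (F : Finset ι) :
    (M ⊓ ⨅ i ∈ F, N i : Subgroup H).Normal := by
  have : (⨅ i ∈ F, N i : Subgroup H).Normal :=
    ⟨fun n hn g => Subgroup.mem_iInf.2 fun i => Subgroup.mem_iInf.2 fun hi =>
      (hN i).normal.conj_mem n (Subgroup.mem_iInf.1 (Subgroup.mem_iInf.1 (hn) i) hi) g⟩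
  exact Subgroup.normal_inf_normal _ _

lemma inf_iInf_insert {ι : Type v} [DecidableEq ι] (M : Subgroup H)
    (N : ι → Subgroup H) (j : ι) (F : Finset ι) :
    M ⊓ ⨅ i ∈ insert j F, N i = (M ⊓ ⨅ i ∈ F, N i) ⊓ N j := by
  rw [Finset.iInf_insert, inf_comm (N j), inf_assoc]

/-- A maximal `N j` with non-abelian `M / N j` does not contain the intersection of finitely many
other maximal ones. -/
lemma not_inf_iInf_le {ι : Type v} {M : Subgroup H} [M.Normal]
    (hMc : IsClosed (M : Set H)) {N : ι → Subgroup H} (hN : ∀ i, IsMaximalNormalIn M (N i))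
    {j : ι} (hj : ∃ x ∈ M, ∃ y ∈ M, ⁅x, y⁆ ∉ N j) (F : Finset ι) (hF : ∀ i ∈ F, N i ≠ N j) :
    ¬ M ⊓ ⨅ i ∈ F, N i ≤ N j := by
  classical
  induction F using Finset.induction_on with
  | empty =>
    simp only [Finset.notMem_empty, iInf_false, iInf_top, inf_top_eq]
    exact (hN j).lt.not_ge
  | insert i F hi ih =>
    rw [inf_iInf_insert]
    intro hle
    have := (hN i).normal
    have := (hN j).normal
    have := normal_inf_iInf hN F
    have h1 := (hN j).sup_eq (isClosed_inf_iInf hMc hN F) inf_le_left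
      (ih fun i hi => hF i (Finset.mem_insert_of_mem hi))
    have h2 := (hN j).sup_eq (hN i).isClosed (hN i).lt.le
      (fun h => hF i (Finset.mem_insert_self _ _) ((hN i).eq_of_le (hN j) h))
    -- Both the old intersection and `N i` cover `M` modulo `N j`; if they met inside `N j`, then `M
    -- / N j` would be abelian.
    obtain ⟨x, hx, y, hy, hxy⟩ := hj
    exact hxy (commutator_mem_of_inf_le hle h1 h2 hx hy)

lemma IndependentIn.insert_of_not_le {ι : Type v} [DecidableEq ι] {M : Subgroup H} [M.Normal]
    (hMc : IsClosed (M : Set H)) {N : ι → Subgroup H} (hN : ∀ i, IsMaximalNormalIn M (N i))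
    {F : Finset ι} (hF : IndependentIn M N F) {j : ι} (hj : ¬ M ⊓ ⨅ i ∈ F, N i ≤ N j) :
    IndependentIn M N (Insert.insert j F) := by
  have := (hN j).normal
  have := normal_inf_iInf hN F
  exact hF.insert_of_sup_eq ((hN j).sup_eq (isClosed_inf_iInf hMc hN F) inf_le_left hj)

/-- Systems of cosets of infinitely many independent closed subgroups have a common
representative. -/
lemma exists_common_representative {ι : Type v} {M : Subgroup H}
    (hMc : IsClosed (M : Set H)) {N : ι → Subgroup H} (hN : ∀ i, IsClosed (N i : Set H))
    (hind : ∀ F : Finset ι, IndependentIn M N F) (x : ι → H) (hx : ∀ i, x i ∈ M) :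
    ∃ k ∈ M, ∀ i, (x i)⁻¹ * k ∈ N i := by
  obtain ⟨k, hk, hki⟩ := hMc.isCompact.inter_iInter_nonempty
    (fun i => {k | (x i)⁻¹ * k ∈ N i})
    (fun i => (hN i).preimage (continuous_const_mul _)) (fun F => by
      obtain ⟨k, hk, hkF⟩ := hind F x hx
      exact ⟨k, hk, Set.mem_iInter₂.2 hkF⟩)
  exact ⟨k, hk, Set.mem_iInter.1 hki⟩

end Maximal

end Independence

/-! ### Gluing closed relations to a homomorphism. -/

section Gluing

variable {H G H' G' : Type u}
    [Group H] [TopologicalSpace H] [IsTopologicalGroup H]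
    [CompactSpace H] [TotallyDisconnectedSpace H]
    [Group G] [TopologicalSpace G] [IsTopologicalGroup G]
    [CompactSpace G] [TotallyDisconnectedSpace G]
    [Group H'] [TopologicalSpace H'] [IsTopologicalGroup H']
    [CompactSpace H'] [TotallyDisconnectedSpace H']
    [Group G'] [TopologicalSpace G'] [IsTopologicalGroup G']
    [CompactSpace G'] [TotallyDisconnectedSpace G']

lemma isClosed_ker (τ : H →ₜ* G) : IsClosed (τ.toMonoidHom.ker : Set H) :=
  isClosed_singleton.preimage τ.continuous_toFun

variable {τ : H →ₜ* G} {τ' : H' →ₜ* G'} {π : G →ₜ* G'}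

/-- The underlying group of `H ×_{G'} H'`, with respect to `π ∘ τ` and `τ'`. -/
def overProduct (τ : H →ₜ* G) (τ' : H' →ₜ* G') (π : G →ₜ* G') : Subgroup (H × H') :=
  ((π.toMonoidHom.comp τ.toMonoidHom).comp (MonoidHom.fst H H')).eqLocus
    (τ'.toMonoidHom.comp (MonoidHom.snd H H'))

lemma mem_overProduct {p : H × H'} : p ∈ overProduct τ τ' π ↔ π (τ p.1) = τ' p.2 := Iff.rfl

lemma isClosed_overProduct (τ : H →ₜ* G) (τ' : H' →ₜ* G') (π : G →ₜ* G') :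
    IsClosed (overProduct τ τ' π : Set (H × H')) :=
  isClosed_eq (π.continuous_toFun.comp (τ.continuous_toFun.comp continuous_fst))
    (τ'.continuous_toFun.comp continuous_snd)

/-- A closed subgroup of a product that is the graph of a function is the graph of a continuous
homomorphism. -/
lemma exists_hom_of_isClosed_graph (Γ : Subgroup (H × H')) (hΓ : IsClosed (Γ : Set (H × H')))
    (hex : ∀ h, ∃ h', (h, h') ∈ Γ) (huniq : ∀ h', ((1 : H), h') ∈ Γ → h' = 1) :
    ∃ θ : H →ₜ* H', ∀ h h', (h, h') ∈ Γ ↔ θ h = h' := by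
  choose f hf using hex
  have hfu : ∀ h h', (h, h') ∈ Γ ↔ f h = h' := by
    intro h h'
    constructor
    · intro hh
      have := Γ.mul_mem (Γ.inv_mem (hf h)) hh
      have h1 := huniq ((f h)⁻¹ * h') (by simpa using this)
      exact inv_mul_eq_one.1 h1
    · rintro rfl; exact hf h
  refine ⟨{ toMonoidHom := MonoidHom.mk' f fun a b =>
              (hfu _ _).1 (Γ.mul_mem (hf a) (hf b)), continuous_toFun := ?_ }, hfu⟩
  refine continuous_iff_isClosed.2 fun C hC => ?_
  have : f ⁻¹' C = Prod.fst '' ((Γ : Set (H × H')) ∩ Prod.snd ⁻¹' C) := by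
    ext h
    constructor
    · intro hh; exact ⟨(h, f h), ⟨hf h, hh⟩, rfl⟩
    · rintro ⟨⟨a, b⟩, ⟨hab, hb⟩, rfl⟩
      have := (hfu _ _).1 hab
      change f a ∈ C
      rw [this]; exact hb
  change IsClosed (f ⁻¹' C)
  rw [this]
  exact ((hΓ.inter (hC.preimage continuous_snd)).isCompact.image continuous_fst).isClosed

/-- Gluing of closed relations between `H` and `H'`, over `π`, that become homomorphisms modulo
independent families of normal subgroups. -/
theorem exists_semiCartesian_of_relations {ι : Type v}
    (τ : H →ₜ* G) (τ' : H' →ₜ* G') (hτ' : Function.Surjective τ')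
    (π : G →ₜ* G')
    (R : ι → Subgroup (H × H')) (M : ι → Subgroup H) (N : ι → Subgroup H')
    (hRc : ∀ i, IsClosed (R i : Set (H × H')))
    (hRπ : ∀ i, ∀ p ∈ R i, τ' p.2 = π (τ p.1))
    (hR : ∀ i h, ∃ h', (h, h') ∈ R i)
    (hR' : ∀ i, ∀ k' ∈ τ'.toMonoidHom.ker, ∃ k ∈ τ.toMonoidHom.ker, (k, k') ∈ R i)
    (hM : ∀ i, ∀ k ∈ M i, (k, 1) ∈ R i)
    (hN : ∀ i h', (1, h') ∈ R i ↔ h' ∈ N i)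
    (hMc : ∀ i, IsClosed (M i : Set H)) (hNc : ∀ i, IsClosed (N i : Set H'))
    (hMind : ∀ F : Finset ι, IndependentIn τ.toMonoidHom.ker M F)
    (hNind : ∀ F : Finset ι, IndependentIn τ'.toMonoidHom.ker N F)
    (hbot : ∀ k ∈ τ'.toMonoidHom.ker, (∀ i, k ∈ N i) → k = 1) :
    ∃ θ : H →ₜ* H', IsSemiCartesian θ τ τ' π := by
  have hT : ∀ p : H × H', p ∈ overProduct τ τ' π ↔ π (τ p.1) = τ' p.2 :=
    fun _ => mem_overProduct
  have hΓc : IsClosed ((overProduct τ τ' π ⊓ ⨅ i, R i : Subgroup (H × H')) : Set (H × H')) := by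
    simp only [Subgroup.coe_inf, Subgroup.coe_iInf]
    exact (isClosed_overProduct τ τ' π).inter (isClosed_iInter hRc)
  obtain ⟨θ, hθ⟩ := exists_hom_of_isClosed_graph (overProduct τ τ' π ⊓ ⨅ i, R i) hΓc (by
    intro h
    choose x hx using fun i => hR i h
    obtain ⟨h0, hh0⟩ := hτ' (π (τ h))
    -- The image of `h` under the `i`-th relation is the coset `x i * N i`. Relative to one lift
    -- `h0` of `π (τ h)` these become cosets in `Ker τ'`, where independence applies.
    obtain ⟨k, hk, hki⟩ := exists_common_representative (isClosed_ker τ') hNc hNind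
      (fun i => h0⁻¹ * x i) (fun i => by
        change τ' (h0⁻¹ * x i) = 1
        rw [map_mul, map_inv, hh0, hRπ i _ (hx i), inv_mul_cancel])
    refine ⟨h0 * k, (hT _).2 ?_, Subgroup.mem_iInf.2 fun i => ?_⟩
    · have hk1 : τ' k = 1 := hk
      change π (τ h) = τ' (h0 * k)
      rw [map_mul, hk1, hh0, mul_one]
    · have := (R i).mul_mem (hx i) ((hN i _).2 (hki i))
      simpa [mul_assoc] using this) (by
    rintro h' ⟨h1, h2⟩
    have h1 := (hT _).1 h1
    refine hbot h' ?_ fun i => (hN i _).1 (Subgroup.mem_iInf.1 h2 i)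
    change τ' h' = 1
    simpa using h1.symm)
  have hcomm : ∀ h, τ' (θ h) = π (τ h) := fun h => ((hT _).1 ((hθ h _).2 rfl).1).symm
  refine ⟨θ, hcomm, le_antisymm ?_ ?_⟩
  · rintro _ ⟨k, hk, rfl⟩
    change τ' (θ k) = 1
    have hk : τ k = 1 := hk
    rw [hcomm, hk, map_one]
  · intro k' hk'
    choose x hxK hx using fun i => hR' i k' hk'
    -- Each relation alone relates some `x i` in `Ker τ` to `k'`, and still does after changing `x
    -- i` within its coset of `M i`; independence of the `M i` makes one `k` serve all `i`.
    obtain ⟨k, hk, hki⟩ := exists_common_representative (isClosed_ker τ) hMc hMind x hxK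
    refine ⟨k, hk, (hθ _ _).1 ⟨(hT _).2 ?_, Subgroup.mem_iInf.2 fun i => ?_⟩⟩
    · have hk : τ k = 1 := hk
      have hk' : τ' k' = 1 := hk'
      change π (τ k) = τ' k'
      rw [hk, hk', map_one]
    · have := (R i).mul_mem (hx i) (hM i _ (hki i))
      simpa using this

/-- Lift the image of `y` in `G'` to `H`; the error lies in `Ker τ'`, which is the image of `Ker τ`.
-/
lemma IsSemiCartesian.surjective {θ : H →ₜ* H'} {τ : H →ₜ* G} {τ' : H' →ₜ* G'} {π : G →ₜ* G'}
    (h : IsSemiCartesian θ τ τ' π) (hτ : Function.Surjective τ) (hπ : Function.Surjective π) :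
    Function.Surjective θ := by
  intro y
  obtain ⟨g, hg⟩ := hπ (τ' y)
  obtain ⟨x, rfl⟩ := hτ g
  have : (θ x)⁻¹ * y ∈ τ'.toMonoidHom.ker := by
    change τ' ((θ x)⁻¹ * y) = 1
    rw [map_mul, map_inv, h.1, hg, inv_mul_cancel]
  rw [← h.2] at this
  obtain ⟨k, -, hk⟩ := this
  have hk : θ k = (θ x)⁻¹ * y := hk
  exact ⟨x * k, by rw [map_mul, hk, mul_inv_cancel_left]⟩

end Gluing

/-! ### Equivariant homomorphisms from the kernel to a module. -/

section Dual

variable {H G A : Type u} [Group H] [TopologicalSpace H] [Group G] [TopologicalSpace G]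
  [AddCommGroup A] {τ : H →ₜ* G} {ρ : Representation ℤ G A}

lemma kerDual_mul (ψ : kerDual τ ρ) (x y : τ.toMonoidHom.ker) : ψ.1 (x * y) = ψ.1 x + ψ.1 y :=
  ψ.2.2.1 x y

lemma kerDual_one (ψ : kerDual τ ρ) : ψ.1 1 = 0 := by
  have := kerDual_mul ψ 1 1
  rwa [one_mul, left_eq_add] at this

lemma kerDual_inv (ψ : kerDual τ ρ) (x : τ.toMonoidHom.ker) : ψ.1 x⁻¹ = - ψ.1 x := by
  have := kerDual_mul ψ x⁻¹ x
  rw [inv_mul_cancel, kerDual_one] at this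
  exact eq_neg_of_add_eq_zero_left this.symm

lemma kerDual_conj (ψ : kerDual τ ρ) (e : H) (x : τ.toMonoidHom.ker) :
    ψ.1 (MulAut.conjNormal e x) = ρ (τ e) (ψ.1 x) :=
  ψ.2.2.2 e x

/-- A normal subgroup of `H` in `Ker τ` is killed by, or mapped onto the simple module `A` by,
an equivariant homomorphism. -/
lemma kerDual_zero_or_surjective (hτ : Function.Surjective τ) (hρ : IsFiniteSimple ρ)
    (ψ : kerDual τ ρ) (L : Subgroup τ.toMonoidHom.ker)
    (hL : ∀ e : H, ∀ x ∈ L, MulAut.conjNormal e x ∈ L) :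
    (∀ x ∈ L, ψ.1 x = 0) ∨ ∀ a, ∃ x ∈ L, ψ.1 x = a := by
  -- The image of `L` is a submodule: each `g` lifts to `H`, where it acts by conjugation and
  -- preserves `L`.
  let B : AddSubgroup A :=
    { carrier := {a | ∃ x ∈ L, ψ.1 x = a}
      zero_mem' := ⟨1, L.one_mem, kerDual_one ψ⟩
      add_mem' := by
        rintro _ _ ⟨x, hx, rfl⟩ ⟨y, hy, rfl⟩
        exact ⟨x * y, L.mul_mem hx hy, kerDual_mul ψ x y⟩
      neg_mem' := by
        rintro _ ⟨x, hx, rfl⟩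
        exact ⟨x⁻¹, L.inv_mem hx, kerDual_inv ψ x⟩ }
  rcases hρ.simple B (by
    rintro g _ ⟨x, hx, rfl⟩
    obtain ⟨e, rfl⟩ := hτ g
    exact ⟨_, hL e x hx, kerDual_conj ψ e x⟩) with h | h
  · left
    intro x hx
    have : ψ.1 x ∈ B := ⟨x, hx, rfl⟩
    rw [h] at this
    exact this
  · right
    intro a
    have : a ∈ B := h ▸ AddSubgroup.mem_top a
    exact this

/-- The kernel of an equivariant homomorphism, as a subgroup of `H`. -/
def dualKernel (ψ : kerDual τ ρ) : Subgroup H where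
  carrier := {h | ∃ hh : h ∈ τ.toMonoidHom.ker, ψ.1 ⟨h, hh⟩ = 0}
  one_mem' := ⟨one_mem _, kerDual_one ψ⟩
  mul_mem' := by
    rintro a b ⟨ha, ha'⟩ ⟨hb, hb'⟩
    refine ⟨mul_mem ha hb, ?_⟩
    have := kerDual_mul ψ ⟨a, ha⟩ ⟨b, hb⟩
    rwa [ha', hb', add_zero] at this
  inv_mem' := by
    rintro a ⟨ha, ha'⟩
    refine ⟨inv_mem ha, ?_⟩
    have := kerDual_inv ψ ⟨a, ha⟩
    rwa [ha', neg_zero] at this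

lemma mem_dualKernel {ψ : kerDual τ ρ} (x : τ.toMonoidHom.ker) :
    x.1 ∈ dualKernel ψ ↔ ψ.1 x = 0 :=
  ⟨fun h => h.2, fun h => ⟨x.2, h⟩⟩

lemma dualKernel_le (ψ : kerDual τ ρ) : dualKernel ψ ≤ τ.toMonoidHom.ker := fun _ h => h.1

instance (ψ : kerDual τ ρ) : (dualKernel ψ).Normal where
  conj_mem := by
    rintro n ⟨hn, hn'⟩ g
    refine ⟨MonoidHom.normal_ker _ |>.conj_mem n hn g, ?_⟩
    have := kerDual_conj ψ g ⟨n, hn⟩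
    rwa [hn', map_zero] at this

lemma kerDual_surjective (hτ : Function.Surjective τ) (hρ : IsFiniteSimple ρ)
    {ψ : kerDual τ ρ} (hψ : ψ ≠ 0) : Function.Surjective ψ.1 := by
  rcases kerDual_zero_or_surjective hτ hρ ψ ⊤ (fun _ _ _ => Subgroup.mem_top _) with h | h
  · exact absurd (Subtype.ext (funext fun x => h x (Subgroup.mem_top x))) hψ
  · intro a
    obtain ⟨x, -, hx⟩ := h a
    exact ⟨x, hx⟩

end Dual

section DualTopology

variable {H G A : Type u} [Group H] [TopologicalSpace H] [IsTopologicalGroup H]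
  [CompactSpace H] [TotallyDisconnectedSpace H]
  [Group G] [TopologicalSpace G] [IsTopologicalGroup G]
  [CompactSpace G] [TotallyDisconnectedSpace G]
  [AddCommGroup A] {τ : H →ₜ* G} {ρ : Representation ℤ G A}

lemma isClosed_dualKernel (ψ : kerDual τ ρ) : IsClosed (dualKernel ψ : Set H) := by
  have h1 : IsClosed {x | ψ.1 x = 0} := ψ.2.1.isClosed_fiber 0
  have h2 := (isClosed_ker τ).isClosedEmbedding_subtypeVal.isClosedMap _ h1
  convert h2 using 1
  ext h
  constructor
  · rintro ⟨hh, h0⟩; exact ⟨⟨h, hh⟩, h0, rfl⟩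
  · rintro ⟨⟨h, hh⟩, h0, rfl⟩; exact ⟨hh, h0⟩

/-- A normal subgroup between the kernel of `ψ` and `Ker τ` has image `0` or `A`, by simplicity; in
the second case it is all of `Ker τ`. -/
lemma isMaximalNormalIn_dualKernel (hτ : Function.Surjective τ) (hρ : IsFiniteSimple ρ)
    {ψ : kerDual τ ρ} (hψ : ψ ≠ 0) : IsMaximalNormalIn τ.toMonoidHom.ker (dualKernel ψ) := by
  have := hρ.nontrivial
  obtain ⟨a, ha⟩ := exists_ne (0 : A)
  obtain ⟨x, hx⟩ := kerDual_surjective hτ hρ hψ a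
  refine ⟨⟨inferInstance, isClosed_dualKernel ψ, lt_of_le_of_ne (dualKernel_le ψ) fun h => ?_⟩, ?_⟩
  · apply ha
    rw [← hx, ← mem_dualKernel, h]
    exact x.2
  · rintro L ⟨hLn, -, hLlt⟩ hle l hl
    have hlK := hLlt.le hl
    rcases kerDual_zero_or_surjective hτ hρ ψ (L.subgroupOf τ.toMonoidHom.ker)
      (fun e y hy => hLn.conj_mem y hy e) with h | h
    · exact ⟨hlK, h ⟨l, hlK⟩ hl⟩
    · refine absurd (le_antisymm hLlt.le fun k hk => ?_) hLlt.ne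
      obtain ⟨y, hy, hyk⟩ := h (ψ.1 ⟨k, hk⟩)
      have h0 : ψ.1 (y⁻¹ * ⟨k, hk⟩) = 0 := by
        rw [kerDual_mul, kerDual_inv, hyk, neg_add_cancel]
      have := hle ((mem_dualKernel _).2 h0)
      have h2 : (y * (y⁻¹ * ⟨k, hk⟩)).1 ∈ L := L.mul_mem (Subgroup.mem_subgroupOf.1 hy) this
      rwa [mul_inv_cancel_left] at h2

end DualTopology

section EndRing

variable {G A : Type u} [Group G] [TopologicalSpace G] [AddCommGroup A]
  {ρ : Representation ℤ G A}

lemma IsFiniteSimple.nontrivial_endRing (hρ : IsFiniteSimple ρ) : Nontrivial (EndRing ρ) := by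
  have := hρ.nontrivial
  obtain ⟨a, ha⟩ := exists_ne (0 : A)
  exact ⟨1, 0, fun h => ha (by rw [← one_smul (EndRing ρ) a, h, zero_smul])⟩

end EndRing

/-! ### Joint kernels and linear spans. -/

section Span

variable {H G : Type u} [Group H] [TopologicalSpace H] [Group G] [TopologicalSpace G]
  {τ : H →ₜ* G} {C : Type*} {A : C → Type u} [∀ c, AddCommGroup (A c)]
  {ρ : ∀ c, Representation ℤ G (A c)} {B : C → Type*}

/-- An equivariant additive endomorphism as an element of `End_G(A)`. -/
def endRingMk {A : Type u} [AddCommGroup A] (ρ : Representation ℤ G A) (f : A →+ A)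
    (hf : ∀ g a, f (ρ g a) = ρ g (f a)) : EndRing ρ :=
  ⟨f.toIntLinearMap, (Subalgebra.mem_centralizer_iff ℤ).2 (by
    rintro _ ⟨g, rfl⟩
    ext a
    exact (hf g a).symm)⟩

/-- If `ψ` factors through `φ` on a normal subgroup, the factor is an equivariant map. -/
lemma exists_equivariant_factor {A₁ A₂ : Type u} [AddCommGroup A₁] [AddCommGroup A₂]
    {ρ₁ : Representation ℤ G A₁} {ρ₂ : Representation ℤ G A₂} (hτ : Function.Surjective τ)
    (φ : kerDual τ ρ₁) (ψ : kerDual τ ρ₂) (L : Subgroup τ.toMonoidHom.ker)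
    (hL : ∀ e : H, ∀ x ∈ L, MulAut.conjNormal e x ∈ L)
    (hφ : ∀ a, ∃ x ∈ L, φ.1 x = a) (hle : ∀ x ∈ L, φ.1 x = 0 → ψ.1 x = 0) :
    ∃ f : A₁ →+ A₂, (∀ g a, f (ρ₁ g a) = ρ₂ g (f a)) ∧ ∀ x ∈ L, ψ.1 x = f (φ.1 x) := by
  choose s hsL hs using hφ
  have key : ∀ x ∈ L, ∀ y ∈ L, φ.1 x = φ.1 y → ψ.1 x = ψ.1 y := by
    intro x hx y hy h
    have := hle (x * y⁻¹) (L.mul_mem hx (L.inv_mem hy)) (by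
      rw [kerDual_mul, kerDual_inv, h, add_neg_cancel])
    rw [kerDual_mul, kerDual_inv] at this
    exact add_neg_eq_zero.1 this
  refine ⟨AddMonoidHom.mk' (fun a => ψ.1 (s a)) fun a b => ?_, fun g a => ?_, fun x hx => ?_⟩
  · rw [← kerDual_mul]
    exact key _ (hsL _) _ (L.mul_mem (hsL _) (hsL _)) (by rw [kerDual_mul, hs, hs, hs])
  · obtain ⟨e, rfl⟩ := hτ g
    change ψ.1 (s _) = ρ₂ (τ e) (ψ.1 (s a))
    rw [← kerDual_conj]
    exact key _ (hsL _) _ (hL _ _ (hsL _)) (by rw [kerDual_conj, hs, hs])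
  · exact key _ hx _ (hsL _) (hs _).symm

/-- The analogue of the fact that a linear form vanishing on the common kernel of finitely many
forms is their combination. Modules that are not isomorphic do not contribute, because `hne` leaves
only zero maps between them. -/
lemma mem_span_of_kernel_le (hτ : Function.Surjective τ) (hρ : ∀ c, IsFiniteSimple (ρ c))
    (hne : ∀ c c' (f : A c →+ A c'), (∀ g a, f (ρ c g a) = ρ c' g (f a)) → f ≠ 0 → c = c')
    (ψ : ∀ i : Σ c, B c, kerDual τ (ρ i.1)) (F : Finset (Σ c, B c)) (c : C)
    (φ : kerDual τ (ρ c)) (h : ∀ x, (∀ i ∈ F, (ψ i).1 x = 0) → φ.1 x = 0) :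
    φ ∈ Submodule.span (M := kerDual τ (ρ c)) (EndRing (ρ c)) ((fun b => ψ ⟨c, b⟩) '' {b | (⟨c, b⟩ : Σ c, B c) ∈ F}) := by
  classical
  induction F using Finset.induction_on generalizing φ with
  | empty =>
    have : φ = 0 := Subtype.ext (funext fun x => h x (by simp))
    rw [this]; exact Submodule.zero_mem _
  | insert i F hi ih =>
    have hmono := Submodule.span_mono (R := EndRing (ρ c))
      (Set.image_mono (β := kerDual τ (ρ c)) (f := fun b => ψ ⟨c, b⟩) (s := {b | (⟨c, b⟩ : Σ c, B c) ∈ F})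
        (t := {b | (⟨c, b⟩ : Σ c, B c) ∈ Insert.insert i F})
        (fun b hb => Finset.mem_insert_of_mem hb))
    let L : Subgroup τ.toMonoidHom.ker :=
      { carrier := {x | ∀ i ∈ F, (ψ i).1 x = 0}
        one_mem' := fun i _ => kerDual_one _
        mul_mem' := fun {x y} hx hy i hi => by rw [kerDual_mul, hx i hi, hy i hi, add_zero]
        inv_mem' := fun {x} hx i hi => by rw [kerDual_inv, hx i hi, neg_zero] }
    have hL : ∀ e : H, ∀ x ∈ L, MulAut.conjNormal e x ∈ L := fun e x hx i hi => by
      rw [kerDual_conj, hx i hi, map_zero]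
    have h' : ∀ x ∈ L, (ψ i).1 x = 0 → φ.1 x = 0 := fun x hx h0 => h x fun j hj => by
      rcases Finset.mem_insert.1 hj with rfl | hj
      · exact h0
      · exact hx j hj
    -- On the common kernel `L` of the earlier maps, `ψ i` is zero (hence redundant) or onto. In the
    -- latter case `φ = f ∘ ψ i` on `L`, and if `f ≠ 0`, the induction hypothesis applies to `φ - f
    -- • ψ i`.
    rcases kerDual_zero_or_surjective hτ (hρ _) (ψ i) L hL with h0 | hs
    · exact hmono (ih φ fun x hx => h' x hx (h0 x hx))
    · obtain ⟨f, hf, hfx⟩ := exists_equivariant_factor hτ (ψ i) φ L hL hs h'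
      by_cases hf0 : f = 0
      · exact hmono (ih φ fun x hx => by rw [hfx x hx, hf0]; rfl)
      · obtain ⟨c', b⟩ := i
        obtain rfl := hne _ _ f hf hf0
        have h1 := ih (φ - endRingMk _ f hf • ψ ⟨c', b⟩) fun x hx => by
          change φ.1 x - f ((ψ ⟨c', b⟩).1 x) = 0
          rw [hfx x hx, sub_self]
        have h2 : endRingMk _ f hf • ψ ⟨c', b⟩ ∈ Submodule.span (M := kerDual τ (ρ c'))
            (EndRing (ρ c')) ((fun b => ψ ⟨c', b⟩) '' {b' | (⟨c', b'⟩ : Σ c, B c) ∈ Insert.insert ⟨c', b⟩ F}) :=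
          Submodule.smul_mem _ _ (Submodule.subset_span ⟨b, Finset.mem_insert_self _ _, rfl⟩)
        have := Submodule.add_mem _ (hmono h1) h2
        rwa [sub_add_cancel] at this

end Span

/-! ### Independence of abelian and non-abelian quotients together. -/

section Combined

variable {H G : Type u} [Group H] [TopologicalSpace H] [IsTopologicalGroup H]
  [CompactSpace H] [TotallyDisconnectedSpace H]
  [Group G] [TopologicalSpace G] [IsTopologicalGroup G]
  [CompactSpace G] [TotallyDisconnectedSpace G]
  {τ : H →ₜ* G} {C : Type*} {A : C → Type u} [∀ c, AddCommGroup (A c)]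
  {ρ : ∀ c, Representation ℤ G (A c)} {B : C → Type*} {J : Type*}

lemma dualKernel_commutator_mem {A : Type u} [AddCommGroup A] {ρ : Representation ℤ G A}
    (ψ : kerDual τ ρ) {x y : H} (hx : x ∈ τ.toMonoidHom.ker) (hy : y ∈ τ.toMonoidHom.ker) :
    ⁅x, y⁆ ∈ dualKernel ψ := by
  change ((⁅(⟨x, hx⟩ : τ.toMonoidHom.ker), ⟨y, hy⟩⁆ : τ.toMonoidHom.ker) : H) ∈ _
  rw [mem_dualKernel, commutatorElement_def, kerDual_mul, kerDual_mul, kerDual_mul, kerDual_inv,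
    kerDual_inv]
  abel

/-- Distinct maximal subgroups with non-abelian quotients, together with the kernels of linearly
independent equivariant homomorphisms to pairwise non-isomorphic simple modules, are
independent. -/
theorem independentIn_sumElim (hτ : Function.Surjective τ) (hρ : ∀ c, IsFiniteSimple (ρ c))
    (hne : ∀ c c' (f : A c →+ A c'), (∀ g a, f (ρ c g a) = ρ c' g (f a)) → f ≠ 0 → c = c')
    (ψ : ∀ i : Σ c, B c, kerDual τ (ρ i.1))
    (hψ : ∀ c, LinearIndependent (M := kerDual τ (ρ c)) (EndRing (ρ c)) fun b => ψ ⟨c, b⟩)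
    (N : J → Subgroup H) (hN : ∀ j, IsMaximalNormalIn τ.toMonoidHom.ker (N j))
    (hNinj : Function.Injective N)
    (hNna : ∀ j, ∃ x ∈ τ.toMonoidHom.ker, ∃ y ∈ τ.toMonoidHom.ker, ⁅x, y⁆ ∉ N j)
    (F : Finset (J ⊕ Σ c, B c)) :
    IndependentIn τ.toMonoidHom.ker (Sum.elim N fun i => dualKernel (ψ i)) F := by
  classical
  have hntr := fun c => (hρ c).nontrivial_endRing
  have hmax : ∀ i, IsMaximalNormalIn τ.toMonoidHom.ker
      (Sum.elim N (fun i => dualKernel (ψ i)) i) := by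
    rintro (j | ⟨c, b⟩)
    · exact hN j
    · exact isMaximalNormalIn_dualKernel hτ (hρ c) ((hψ c).ne_zero b)
  -- The order of insertion matters. The abelian members come first, where linear independence is
  -- available; a non-abelian member may then be added to any maximal subgroups different from it,
  -- by `not_inf_iInf_le`.
  have key : ∀ (R : Finset (Σ c, B c)) (L : Finset J), IndependentIn τ.toMonoidHom.ker
      (Sum.elim N fun i => dualKernel (ψ i)) (L.map ⟨_, Sum.inl_injective⟩ ∪
        R.map ⟨_, Sum.inr_injective⟩) := by
    intro R L
    induction L using Finset.induction_on with
    | empty =>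
      rw [Finset.map_empty, Finset.empty_union]
      induction R using Finset.induction_on with
      | empty => exact independentIn_empty _ _
      | insert i R hi ih =>
        rw [Finset.map_insert]
        refine ih.insert_of_not_le (isClosed_ker τ) hmax ?_
        intro hle
        obtain ⟨c, b⟩ := i
        have := mem_span_of_kernel_le hτ hρ hne ψ R c (ψ ⟨c, b⟩) fun x hx => by
          rw [← mem_dualKernel]
          refine hle ⟨x.2, Subgroup.mem_iInf.2 fun i => Subgroup.mem_iInf.2 fun hi => ?_⟩
          obtain ⟨i, hiR, rfl⟩ := Finset.mem_map.1 hi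
          exact (mem_dualKernel x).2 (hx i hiR)
        exact (hψ c).notMem_span_image (s := {b | (⟨c, b⟩ : Σ c, B c) ∈ R}) hi this
    | insert j L hj ih =>
      rw [Finset.map_insert, Finset.insert_union]
      refine ih.insert_of_not_le (isClosed_ker τ) hmax ?_
      refine not_inf_iInf_le (j := Sum.inl j) (isClosed_ker τ) hmax (hNna j) _ fun i hi => ?_
      rcases Finset.mem_union.1 hi with hi | hi
      · obtain ⟨j', hj', rfl⟩ := Finset.mem_map.1 hi
        intro h
        exact hj (hNinj h ▸ hj')
      · obtain ⟨i, -, rfl⟩ := Finset.mem_map.1 hi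
        intro h
        obtain ⟨x, hx, y, hy, hxy⟩ := hNna j
        refine hxy ?_
        have h : dualKernel (ψ i) = N j := h
        rw [← h]
        exact dualKernel_commutator_mem (ψ i) hx hy
  have := key F.toRight F.toLeft
  intro x hx
  obtain ⟨k, hk, hki⟩ := this x hx
  refine ⟨k, hk, fun i hi => hki i ?_⟩
  rcases i with j | i
  · exact Finset.mem_union_left _ (Finset.mem_map.2 ⟨j, Finset.mem_toLeft.2 hi, rfl⟩)
  · exact Finset.mem_union_right _ (Finset.mem_map.2 ⟨i, Finset.mem_toRight.2 hi, rfl⟩)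

end Combined

/-! ### Lifting semilinear maps and counting nullities. -/

section LinearAlgebra

/-- The lift is a sum: a projection `p` onto `Ker T` followed by an embedding `j` into `Ker S`, plus
`T` followed by a section `g` of `S` on its range. If it kills `v`, applying `S` gives `T v = 0`,
and then `j` forces `v = 0`. -/
lemma exists_injective_lift_of_divisionRing {D V' V W : Type u} [DivisionRing D]
    [AddCommGroup V'] [Module D V'] [AddCommGroup V] [Module D V] [AddCommGroup W] [Module D W]
    (T : V' →ₗ[D] W) (S : V →ₗ[D] W) (hrange : ∀ v', ∃ v, S v = T v')
    (hrank : Module.rank D (LinearMap.ker T) ≤ Module.rank D (LinearMap.ker S)) :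
    ∃ l : V' →ₗ[D] V, Function.Injective l ∧ ∀ v', S (l v') = T v' := by
  obtain ⟨p, hp⟩ := LinearMap.exists_leftInverse_of_injective (LinearMap.ker T).subtype
    (Submodule.ker_subtype _)
  obtain ⟨g, hg⟩ := LinearMap.exists_rightInverse_of_surjective S.rangeRestrict
    (LinearMap.range_rangeRestrict S)
  obtain ⟨j, hj⟩ := rank_le_iff_exists_linearMap.1 hrank
  let T' : V' →ₗ[D] LinearMap.range S := T.codRestrict _ hrange
  have hgT : ∀ v, S (g (T' v)) = T v := fun v =>
    congrArg Subtype.val (LinearMap.congr_fun hg (T' v))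
  refine ⟨(LinearMap.ker S).subtype ∘ₗ j ∘ₗ p + g ∘ₗ T', ?_, fun v => ?_⟩
  · rw [← LinearMap.ker_eq_bot, LinearMap.ker_eq_bot']
    intro v hv
    have hv : (j (p v)).1 + g (T' v) = 0 := hv
    have h0 : T v = 0 := by
      have := congrArg S hv
      rwa [map_add, hgT, (j (p v)).2, zero_add, map_zero] at this
    have h1 : T' v = 0 := Subtype.ext h0
    rw [h1, map_zero, add_zero] at hv
    have h2 : p v = 0 := hj (by rw [map_zero]; exact Subtype.ext hv)
    have h3 := LinearMap.congr_fun hp ⟨v, h0⟩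
    have h3 : p v = ⟨v, h0⟩ := h3
    rw [h2] at h3
    exact (congrArg Subtype.val h3).symm
  · change S ((j (p v)).1 + g (T' v)) = T v
    rw [map_add, hgT, (j (p v)).2, zero_add]

variable {R' R V' W' V W : Type u} [Ring R'] [Nontrivial R'] [Ring R]
  [AddCommGroup V'] [Module R' V'] [AddCommGroup W'] [Module R' W']
  [AddCommGroup V] [Module R V] [AddCommGroup W] [Module R W]

/-- Lifting of a semilinear map, injectively, under the obvious necessary conditions. -/
theorem exists_injective_lift (hR' : ∀ a : R', IsUnit a ∨ a = 0) (σ : R' →+* R)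
    (hσ : Function.Bijective σ) (T : V' →ₛₗ[σ] W) (S : V →ₗ[R] W)
    (hrange : ∀ v', ∃ v, S v = T v')
    (hrank : Module.rank R' (LinearMap.ker T) ≤ Module.rank R (LinearMap.ker S)) :
    ∃ l : V' →ₛₗ[σ] V, Function.Injective l ∧ ∀ v', S (l v') = T v' := by
  let := DivisionRing.ofIsUnitOrEqZero hR'
  -- Restricting scalars along `σ` makes the semilinear problem linear; as `σ` is bijective, the
  -- rank of `Ker S` is unchanged.
  let : Module R' V := Module.compHom V σ
  let : Module R' W := Module.compHom W σ
  let T₁ : V' →ₗ[R'] W :=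
    { toFun := T, map_add' := T.map_add, map_smul' := fun r v => T.map_smulₛₗ r v }
  let S₁ : V →ₗ[R'] W :=
    { toFun := S, map_add' := S.map_add, map_smul' := fun r v => S.map_smul (σ r) v }
  have h1 : Module.rank R' (LinearMap.ker S₁) = Module.rank R (LinearMap.ker S) :=
    rank_eq_of_equiv_equiv σ
      ({ toFun := fun x => ⟨x.1, x.2⟩, invFun := fun x => ⟨x.1, x.2⟩, left_inv := fun _ => rfl,
         right_inv := fun _ => rfl, map_add' := fun _ _ => rfl } :
        LinearMap.ker S₁ ≃+ LinearMap.ker S) hσ (fun _ _ => rfl)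
  obtain ⟨l, hl, hl'⟩ := exists_injective_lift_of_divisionRing T₁ S₁ hrange (by rw [h1]; exact hrank)
  exact ⟨{ toFun := l, map_add' := l.map_add, map_smul' := fun r v => l.map_smul r v }, hl, hl'⟩

/-- Additivity of nullities. -/
theorem rank_ker_domRestrict_add_rank_ker (hR' : ∀ a : R', IsUnit a ∨ a = 0) (σ : R' →+* R)
    (I : W' →ₛₗ[σ] W) (S : V' →ₗ[R'] W') :
    Module.rank R' (LinearMap.ker (I.domRestrict (LinearMap.range S))) +
      Module.rank R' (LinearMap.ker S) = Module.rank R' (LinearMap.ker (I.comp S)) := by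
  have : HasRankNullity.{u} R' := by
    let := DivisionRing.ofIsUnitOrEqZero hR'
    exact DivisionRing.hasRankNullity
  -- `S` maps `Ker (I ∘ S)` onto the kernel of `I` on `Im S`, and its kernel there is all of `Ker
  -- S`.
  let f : LinearMap.ker (I.comp S) →ₗ[R'] LinearMap.ker (I.domRestrict (LinearMap.range S)) :=
    { toFun := fun v => ⟨⟨S v.1, v.1, rfl⟩, v.2⟩
      map_add' := fun v w => Subtype.ext (Subtype.ext (S.map_add _ _))
      map_smul' := fun r v => Subtype.ext (Subtype.ext (S.map_smul _ _)) }
  have hf : Function.Surjective f := by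
    rintro ⟨⟨_, v, rfl⟩, h⟩
    exact ⟨⟨v, h⟩, rfl⟩
  have hk : Module.rank R' (LinearMap.ker f) = Module.rank R' (LinearMap.ker S) :=
    LinearEquiv.rank_eq
      { toFun := fun v => ⟨v.1.1, congrArg (fun x : LinearMap.ker (I.domRestrict (LinearMap.range S)) => x.1.1) v.2⟩
        invFun := fun v => ⟨⟨v.1, by
          have h : S v.1 = 0 := v.2
          change I (S v.1) = 0
          rw [h, map_zero]⟩, Subtype.ext (Subtype.ext v.2)⟩
        left_inv := fun _ => rfl
        right_inv := fun _ => rfl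
        map_add' := fun _ _ => rfl
        map_smul' := fun _ _ => rfl }
  rw [← LinearMap.rank_range_add_rank_ker f, hk, LinearMap.range_eq_top.2 hf, rank_top]

end LinearAlgebra

/-! ### Schur's lemma. -/

section Schur

variable {G A : Type u} [Group G] [TopologicalSpace G] [AddCommGroup A]
  {ρ : Representation ℤ G A}

lemma IsFiniteSimple.bijective_or_eq_zero (hρ : IsFiniteSimple ρ) {A' : Type u} [AddCommGroup A']
    {ρ' : Representation ℤ G A'} (hρ' : IsFiniteSimple ρ') (f : A →+ A')
    (hf : ∀ g a, f (ρ g a) = ρ' g (f a)) : Function.Bijective f ∨ f = 0 := by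
  rcases hρ.simple f.ker (fun g b hb => by
    have hb : f b = 0 := hb
    change f _ = 0
    rw [hf, hb, map_zero]) with h | h
  · rcases hρ'.simple f.range (by
      rintro g _ ⟨b, rfl⟩
      exact ⟨ρ g b, hf g b⟩) with h' | h'
    · right
      ext a
      have : f a ∈ f.range := ⟨a, rfl⟩
      rw [h'] at this
      exact this
    · exact Or.inl ⟨(AddMonoidHom.ker_eq_bot_iff f).1 h, AddMonoidHom.range_eq_top.1 h'⟩
  · right
    ext a
    have : a ∈ f.ker := h ▸ AddSubgroup.mem_top a
    exact this

/-- Schur's lemma. -/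
lemma IsFiniteSimple.isUnit_or_eq_zero (hρ : IsFiniteSimple ρ) (α : EndRing ρ) :
    IsUnit α ∨ α = 0 := by
  let f : A →+ A := AddMonoidHom.mk' (fun a => α • a) fun a b => smul_add α a b
  have hext : ∀ β γ : EndRing ρ, (∀ a : A, β • a = γ • a) → β = γ := fun β γ h =>
    Subtype.ext (LinearMap.ext h)
  rcases hρ.bijective_or_eq_zero hρ f (fun g a => endRing_comm α g a) with h | h
  · left
    let e : A ≃+ A := AddEquiv.ofBijective f h
    have he : ∀ a, α • (e.symm a) = a := fun a => e.apply_symm_apply a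
    have he' : ∀ a, e.symm (α • a) = a := fun a => e.symm_apply_apply a
    let β : EndRing ρ := endRingMk ρ e.symm.toAddMonoidHom fun g a => by
      apply h.1
      change α • (e.symm (ρ g a)) = α • (ρ g (e.symm a))
      rw [he, endRing_comm, he]
    refine ⟨⟨α, β, hext _ _ fun a => ?_, hext _ _ fun a => ?_⟩, rfl⟩
    · rw [mul_smul, one_smul]; exact he a
    · rw [mul_smul, one_smul]; exact he' a
  · right
    exact hext _ _ fun a => by rw [zero_smul]; exact DFunLike.congr_fun h a

end Schur

/-! ### Simplicity and endomorphisms under inflation. -/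

section Inflation

variable {G G' A : Type u} [Group G] [TopologicalSpace G] [Group G'] [TopologicalSpace G']
  [AddCommGroup A]

lemma IsFiniteSimple.inflModule {ρ : Representation ℤ G' A} (hρ : IsFiniteSimple ρ)
    (π : G →ₜ* G') (hπ : Function.Surjective π) : IsFiniteSimple (inflModule π ρ) where
  finite := hρ.finite
  continuous a := (hρ.continuous a).comp_continuous π.continuous_toFun
  nontrivial := hρ.nontrivial
  simple B hB := hρ.simple B fun g b hb => by
    obtain ⟨x, rfl⟩ := hπ g
    exact hB x b hb

/-- Since `π` is onto, `G` and `G'` have the same image in the endomorphisms of `A`, hence the same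
centralizer. -/
lemma endIncl_bijective (π : G →ₜ* G') (hπ : Function.Surjective π) (ρ : Representation ℤ G' A) :
    Function.Bijective (endIncl π ρ) := by
  refine ⟨fun a b h => Subtype.ext (congrArg (fun x : EndRing (inflModule π ρ) => x.1) h), fun b => ⟨⟨b.1, ?_⟩, rfl⟩⟩
  rw [Subalgebra.mem_centralizer_iff]
  rintro _ ⟨g, rfl⟩
  obtain ⟨x, rfl⟩ := hπ g
  exact (Subalgebra.mem_centralizer_iff ℤ).1 b.2 _ ⟨x, rfl⟩

end Inflation

/-! ### Replacing the isotypic quotient by the whole kernel. -/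

section Descent

variable {H G A : Type u} [Group H] [TopologicalSpace H] [IsTopologicalGroup H]
  [CompactSpace H] [TotallyDisconnectedSpace H]
  [Group G] [TopologicalSpace G] [IsTopologicalGroup G]
  [CompactSpace G] [TotallyDisconnectedSpace G]
  [AddCommGroup A] {τ : H →ₜ* G} {ρ : Representation ℤ G A}

/-- The map `Ker τ → Ker (H/N → G)`. -/
def kerQuot (τ : H →ₜ* G) (N : Subgroup H) [N.Normal] (hN : N ≤ τ.toMonoidHom.ker) :
    τ.toMonoidHom.ker →* (inducedMap τ N hN).toMonoidHom.ker where
  toFun k := ⟨(k.1 : H ⧸ N), k.2⟩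
  map_one' := rfl
  map_mul' _ _ := rfl

lemma kerQuot_surjective (τ : H →ₜ* G) (N : Subgroup H) [N.Normal] (hN : N ≤ τ.toMonoidHom.ker) :
    Function.Surjective (kerQuot τ N hN) := by
  rintro ⟨q, hq⟩
  obtain ⟨h, rfl⟩ := QuotientGroup.mk_surjective q
  exact ⟨⟨h, hq⟩, rfl⟩

lemma kerQuot_eq_iff (τ : H →ₜ* G) (N : Subgroup H) [N.Normal] (hN : N ≤ τ.toMonoidHom.ker)
    (x y : τ.toMonoidHom.ker) : kerQuot τ N hN x = kerQuot τ N hN y ↔ (x⁻¹ * y).1 ∈ N := by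
  rw [Subtype.ext_iff]
  exact QuotientGroup.eq

lemma continuous_kerQuot (τ : H →ₜ* G) (N : Subgroup H) [N.Normal]
    (hN : N ≤ τ.toMonoidHom.ker) : Continuous (kerQuot τ N hN) :=
  (continuous_quotient_mk'.comp continuous_subtype_val).subtype_mk _

lemma kerQuot_conj (τ : H →ₜ* G) (N : Subgroup H) [N.Normal] (hN : N ≤ τ.toMonoidHom.ker)
    (e : H) (k : τ.toMonoidHom.ker) : kerQuot τ N hN (MulAut.conjNormal e k) =
      MulAut.conjNormal (e : H ⧸ N) (kerQuot τ N hN k) := rfl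

/-- Restriction along `Ker τ → Ker (H/N → G)`. -/
def kerQuotDual (τ : H →ₜ* G) (N : Subgroup H) [N.Normal] (hN : N ≤ τ.toMonoidHom.ker)
    (ρ : Representation ℤ G A) : kerDual (inducedMap τ N hN) ρ →ₗ[EndRing ρ] kerDual τ ρ where
  toFun φ := ⟨fun k => φ.1 (kerQuot τ N hN k),
    φ.2.1.comp_continuous (continuous_kerQuot τ N hN),
    fun x y => by beta_reduce; rw [map_mul, kerDual_mul],
    fun e x => by beta_reduce; rw [kerQuot_conj, kerDual_conj]; rfl⟩
  map_add' _ _ := rfl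
  map_smul' _ _ := rfl

lemma kerQuotDual_injective (τ : H →ₜ* G) (N : Subgroup H) [N.Normal]
    (hN : N ≤ τ.toMonoidHom.ker) (ρ : Representation ℤ G A) :
    Function.Injective (kerQuotDual τ N hN ρ) := by
  intro φ ψ h
  refine Subtype.ext (funext fun q => ?_)
  obtain ⟨k, rfl⟩ := kerQuot_surjective τ N hN q
  exact congrFun (congrArg Subtype.val h) k

/-- An equivariant homomorphism that kills `N` comes from `H/N`. -/
lemma exists_kerQuotDual_eq (N : Subgroup H) [N.Normal] (hN : N ≤ τ.toMonoidHom.ker)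
    (hNc : IsClosed (N : Set H)) (φ : kerDual τ ρ) (hφ : N ≤ dualKernel φ) :
    ∃ φ', kerQuotDual τ N hN ρ φ' = φ := by
  have : T2Space (inducedMap τ N hN).toMonoidHom.ker := inferInstance
  have hcs : CompactSpace τ.toMonoidHom.ker := isCompact_iff_compactSpace.1 (isClosed_ker τ).isCompact
  -- A continuous surjection from a compact to a Hausdorff space is a quotient map, so local
  -- constancy descends.
  have hq := (continuous_kerQuot τ N hN).isClosedMap.isQuotientMap (continuous_kerQuot τ N hN)
    (kerQuot_surjective τ N hN)
  choose s hs using kerQuot_surjective τ N hN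
  have key : ∀ x y, kerQuot τ N hN x = kerQuot τ N hN y → φ.1 x = φ.1 y := by
    intro x y h
    have := (mem_dualKernel _).1 (hφ ((kerQuot_eq_iff τ N hN x y).1 h))
    rw [kerDual_mul, kerDual_inv] at this
    exact neg_add_eq_zero.1 this
  have hs' : ∀ k, φ.1 (s (kerQuot τ N hN k)) = φ.1 k := fun k => key _ _ (hs _)
  refine ⟨⟨fun q => φ.1 (s q), fun U => ?_, fun x y => ?_, fun e x => ?_⟩,
    Subtype.ext (funext hs')⟩
  · rw [← hq.isOpen_preimage]
    convert φ.2.1 U using 1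
    ext k
    exact iff_of_eq (congrArg (· ∈ U) (hs' k))
  · obtain ⟨x, rfl⟩ := kerQuot_surjective τ N hN x
    obtain ⟨y, rfl⟩ := kerQuot_surjective τ N hN y
    beta_reduce
    rw [← map_mul, hs', hs', hs', kerDual_mul]
  · obtain ⟨x, rfl⟩ := kerQuot_surjective τ N hN x
    obtain ⟨e, rfl⟩ := QuotientGroup.mk_surjective e
    beta_reduce
    rw [← kerQuot_conj, hs', hs', kerDual_conj]
    rfl

lemma dualKernel_mem_moduleQuotients (hτ : Function.Surjective τ) (hρ : IsFiniteSimple ρ)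
    {φ : kerDual τ ρ} (hφ : φ ≠ 0) : dualKernel φ ∈ moduleQuotients τ ρ := by
  refine ⟨inferInstance, dualKernel_le φ, isClosed_dualKernel φ, ?_⟩
  obtain ⟨φ', hφ'⟩ := exists_kerQuotDual_eq (dualKernel φ) (dualKernel_le φ)
    (isClosed_dualKernel φ) φ le_rfl
  have hφk : ∀ k, φ'.1 (kerQuot τ _ (dualKernel_le φ) k) = φ.1 k := fun k =>
    congrFun (congrArg Subtype.val hφ') k
  let f : (inducedMap τ _ (dualKernel_le φ)).toMonoidHom.ker →* Multiplicative A :=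
    { toFun := fun q => Multiplicative.ofAdd (φ'.1 q)
      map_one' := congrArg _ (kerDual_one φ')
      map_mul' := fun x y => congrArg _ (kerDual_mul φ' x y) }
  refine ⟨MulEquiv.ofBijective f ⟨?_, fun a => ?_⟩, fun x k => kerDual_conj φ' x k⟩
  · rw [injective_iff_map_eq_one]
    intro q hq
    obtain ⟨k, rfl⟩ := kerQuot_surjective τ _ (dualKernel_le φ) q
    have hq : φ'.1 (kerQuot τ _ (dualKernel_le φ) k) = 0 := hq
    rw [hφk, ← mem_dualKernel] at hq
    exact Subtype.ext ((QuotientGroup.eq_one_iff _).2 hq)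
  · obtain ⟨k, hk⟩ := kerDual_surjective hτ hρ hφ a.toAdd
    exact ⟨kerQuot τ _ (dualKernel_le φ) k, (congrArg Multiplicative.ofAdd ((hφk k).trans hk))⟩

/-- The kernel of a nonzero `φ` is one of the subgroups intersected in `N_A`. For `φ = 0` the kernel
is `Ker τ`, and the intersection being taken inside `Ker τ` is what helps. -/
lemma isotypicKernel_le_dualKernel (hτ : Function.Surjective τ) (hρ : IsFiniteSimple ρ)
    (φ : kerDual τ ρ) : isotypicKernel τ ρ ≤ dualKernel φ := by
  by_cases hφ : φ = 0
  · subst hφ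
    exact fun k hk => ⟨hk.1, rfl⟩
  · exact inf_le_right.trans (sInf_le (dualKernel_mem_moduleQuotients hτ hρ hφ))

lemma isClosed_isotypicKernel (τ : H →ₜ* G) (ρ : Representation ℤ G A) :
    IsClosed (isotypicKernel τ ρ : Set H) := by
  simp only [isotypicKernel, Subgroup.coe_inf, Subgroup.coe_sInf]
  refine (isClosed_ker τ).inter (isClosed_biInter fun N hN => ?_)
  obtain ⟨_, _, h, _⟩ := hN
  exact h

/-- `Hom_G(B_A, A) = Hom_G(Ker τ, A)`. -/
noncomputable def isotypicDualEquiv (hτ : Function.Surjective τ) (hρ : IsFiniteSimple ρ) :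
    kerDual (isotypicMap τ ρ) ρ ≃ₗ[EndRing ρ] kerDual τ ρ :=
  LinearEquiv.ofBijective (kerQuotDual τ (isotypicKernel τ ρ) inf_le_left ρ)
    ⟨kerQuotDual_injective _ _ _ _, fun φ => exists_kerQuotDual_eq _ _
      (isClosed_isotypicKernel τ ρ) φ (isotypicKernel_le_dualKernel hτ hρ φ)⟩

/-- A section of `τ` composed with the quotient map is a section of `H/N_A → G`, and any continuous
section computes the extension map. Hence support and multiplicity can be read off from `Hom_G(Ker
τ, A)`. -/
lemma isotypicS_eq (hτ : Function.Surjective τ) (hρ : IsFiniteSimple ρ) :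
    isotypicS τ hτ ρ =
      (extensionMap τ (exists_section τ hτ) ρ).comp (isotypicDualEquiv hτ hρ).toLinearMap := by
  obtain ⟨s, hs⟩ := exists_section τ hτ
  ext φ
  have h1 := extensionMap_apply (isotypicMap τ ρ)
    ⟨fun g => (s g : IsotypicQuotient τ ρ), continuous_quotient_mk'.comp s.continuous⟩ hs ρ φ
  have h2 := extensionMap_apply τ s hs ρ (isotypicDualEquiv hτ hρ φ)
  exact h1.trans h2.symm

lemma moduleSupp_eq (hτ : Function.Surjective τ) (hρ : IsFiniteSimple ρ) :
    moduleSupp τ hτ ρ = LinearMap.range (extensionMap τ (exists_section τ hτ) ρ) := by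
  rw [moduleSupp, isotypicS_eq hτ hρ, LinearMap.range_comp, LinearEquiv.range,
    Submodule.map_top]

lemma moduleMult_eq (hτ : Function.Surjective τ) (hρ : IsFiniteSimple ρ) :
    moduleMult τ hτ ρ =
      Module.rank (EndRing ρ) (LinearMap.ker (extensionMap τ (exists_section τ hτ) ρ)) := by
  rw [moduleMult, isotypicS_eq hτ hρ, LinearMap.ker_comp]
  exact LinearEquiv.rank_eq
    ((isotypicDualEquiv hτ hρ).submoduleMap _ ≪≫ₗ LinearEquiv.ofEq _ _
      (Submodule.map_comap_eq_of_surjective (isotypicDualEquiv hτ hρ).surjective _))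

end Descent

/-! ### Compatibility with commutative squares; conditions (b) and (c). -/

section Naturality

variable {H G H' G' A : Type u}
    [Group H] [TopologicalSpace H] [IsTopologicalGroup H]
    [CompactSpace H] [TotallyDisconnectedSpace H]
    [Group G] [TopologicalSpace G] [IsTopologicalGroup G]
    [CompactSpace G] [TotallyDisconnectedSpace G]
    [Group H'] [TopologicalSpace H'] [IsTopologicalGroup H']
    [CompactSpace H'] [TotallyDisconnectedSpace H']
    [Group G'] [TopologicalSpace G'] [IsTopologicalGroup G']
    [CompactSpace G'] [TotallyDisconnectedSpace G'] [AddCommGroup A]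
    {τ : H →ₜ* G} {τ' : H' →ₜ* G'} {π : G →ₜ* G'}

/-- The map `Ker τ → Ker τ'` given by a commutative square. -/
def kerMap (θ : H →ₜ* H') (h : ∀ x, τ' (θ x) = π (τ x)) :
    τ.toMonoidHom.ker →* τ'.toMonoidHom.ker where
  toFun k := ⟨θ k.1, by
    have hk : τ k.1 = 1 := k.2
    change τ' (θ k.1) = 1
    rw [h, hk, map_one]⟩
  map_one' := Subtype.ext (map_one θ)
  map_mul' x y := Subtype.ext (map_mul θ x.1 y.1)

/-- Pulling back `Hom_{G'}(Ker τ', A) → Hom_G(Ker τ, Inf_π A)` along a commutative square. -/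
def kerMapDual (θ : H →ₜ* H') (h : ∀ x, τ' (θ x) = π (τ x)) (ρ : Representation ℤ G' A) :
    kerDual τ' ρ →ₛₗ[endIncl π ρ] kerDual τ (inflModule π ρ) where
  toFun φ := ⟨fun k => φ.1 (kerMap θ h k),
    φ.2.1.comp_continuous ((θ.continuous_toFun.comp continuous_subtype_val).subtype_mk _),
    fun x y => by beta_reduce; rw [map_mul, kerDual_mul],
    fun e x => by
      have h1 : kerMap θ h (MulAut.conjNormal e x) = MulAut.conjNormal (θ e) (kerMap θ h x) :=
        Subtype.ext (by
          change θ (e * x.1 * e⁻¹) = θ e * θ x.1 * (θ e)⁻¹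
          rw [map_mul, map_mul, map_inv])
      beta_reduce
      rw [h1, kerDual_conj, h]
      rfl⟩
  map_add' _ _ := rfl
  map_smul' _ _ := rfl

lemma kerMapDual_injective (θ : H →ₜ* H') (h : IsSemiCartesian θ τ τ' π)
    (ρ : Representation ℤ G' A) : Function.Injective (kerMapDual θ h.1 ρ) := by
  intro φ ψ hφψ
  refine Subtype.ext (funext fun k => ?_)
  obtain ⟨k, hk⟩ := k
  have hk' := hk
  rw [← h.2] at hk'
  obtain ⟨x, hx, rfl⟩ := hk'
  exact congrFun (congrArg Subtype.val hφψ) ⟨x, hx⟩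

/-- The maps `S` are compatible with inflation. -/
lemma extensionMap_kerMapDual (hτ : ∃ s : C(G, H), ∀ g, τ (s g) = g)
    (hτ' : ∃ s : C(G', H'), ∀ g, τ' (s g) = g) (θ : H →ₜ* H') (h : ∀ x, τ' (θ x) = π (τ x))
    (ρ : Representation ℤ G' A) (φ : kerDual τ' ρ) :
    extensionMap τ hτ (inflModule π ρ) (kerMapDual θ h ρ φ) =
      inflH2 π ρ (extensionMap τ' hτ' ρ φ) := by
  obtain ⟨s, hs⟩ := hτ
  obtain ⟨t, ht⟩ := hτ'
  rw [extensionMap_apply τ s hs, extensionMap_apply τ' t ht]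
  change _ = Submodule.Quotient.mk (inflCocycles π ρ (cocycleMap τ' t ht ρ φ))
  rw [Submodule.Quotient.eq]
  -- The discrepancy between the two lifts `θ ∘ s` and `t ∘ π` of `π`; `φ ∘ c` cobounds the
  -- difference of the two cocycles.
  let c : G → τ'.toMonoidHom.ker := fun g => ⟨θ (s g) * (t (π g))⁻¹, by
    change τ' (θ (s g) * (t (π g))⁻¹) = 1
    rw [map_mul, map_inv, h, hs, ht, mul_inv_cancel]⟩
  refine ⟨fun g => φ.1 (c g), φ.2.1.comp_continuous ?_, fun x y => ?_⟩
  · have h1 := s.continuous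
    have h2 := t.continuous
    have h3 : Continuous θ := θ.continuous_toFun
    have h4 : Continuous π := π.continuous_toFun
    fun_prop
  · have key : kerMap θ h (factorSet τ s hs (x, y)) * c (x * y) =
        c x * (MulAut.conjNormal (t (π x)) (c y) * factorSet τ' t ht (π x, π y)) := by
      apply Subtype.ext
      change θ (s x * s y * (s (x * y))⁻¹) * (θ (s (x * y)) * (t (π (x * y)))⁻¹) =
        θ (s x) * (t (π x))⁻¹ * (t (π x) * (θ (s y) * (t (π y))⁻¹) * (t (π x))⁻¹ *
          (t (π x) * t (π y) * (t (π x * π y))⁻¹))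
      simp only [map_mul, map_inv]
      group
    have h := congrArg φ.1 key
    rw [kerDual_mul, kerDual_mul, kerDual_mul, kerDual_conj, ht] at h
    change φ.1 (kerMap θ _ (factorSet τ s hs (x, y))) - φ.1 (factorSet τ' t ht (π x, π y)) =
      ρ (π x) (φ.1 (c y)) - φ.1 (c (x * y)) + φ.1 (c x)
    rw [eq_sub_of_add_eq h]
    abel

/-- The value of `ν + mult` as the nullity of one linear map. -/
lemma inflNullity_add_moduleMult (hτ' : Function.Surjective τ') {ρ : Representation ℤ G' A}
    (hρ : IsFiniteSimple ρ) : inflNullity π τ' hτ' ρ + moduleMult τ' hτ' ρ =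
      Module.rank (EndRing ρ) (LinearMap.ker
        ((inflH2 π ρ).comp (extensionMap τ' (exists_section τ' hτ') ρ))) := by
  have := hρ.nontrivial_endRing
  rw [moduleMult_eq hτ' hρ, inflNullity, moduleSupp_eq hτ' hρ]
  exact rank_ker_domRestrict_add_rank_ker hρ.isUnit_or_eq_zero _ _ _

theorem IsSemiCartesian.inflH2_moduleSupp_subset (hτ : Function.Surjective τ)
    (hτ' : Function.Surjective τ') (hπ : Function.Surjective π) {θ : H →ₜ* H'}
    (h : IsSemiCartesian θ τ τ' π) {ρ : Representation ℤ G' A} (hρ : IsFiniteSimple ρ) :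
    inflH2 π ρ '' (moduleSupp τ' hτ' ρ : Set (H2 ρ)) ⊆
      (moduleSupp τ hτ (inflModule π ρ) : Set (H2 (inflModule π ρ))) := by
  rw [moduleSupp_eq hτ' hρ, moduleSupp_eq hτ (hρ.inflModule π hπ)]
  rintro _ ⟨_, ⟨φ, rfl⟩, rfl⟩
  exact ⟨_, extensionMap_kerMapDual _ _ θ h.1 ρ φ⟩

theorem IsSemiCartesian.inflNullity_add_moduleMult_le (hτ : Function.Surjective τ)
    (hτ' : Function.Surjective τ') (hπ : Function.Surjective π) {θ : H →ₜ* H'}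
    (h : IsSemiCartesian θ τ τ' π) {ρ : Representation ℤ G' A} (hρ : IsFiniteSimple ρ) :
    inflNullity π τ' hτ' ρ + moduleMult τ' hτ' ρ ≤ moduleMult τ hτ (inflModule π ρ) := by
  rw [inflNullity_add_moduleMult hτ' hρ, moduleMult_eq hτ (hρ.inflModule π hπ)]
  -- The rank comparison needs a map from the scalars of the target to those of the source, so the
  -- inverse of `endIncl` is used.
  obtain ⟨e, -, he⟩ := Function.bijective_iff_has_inverse.1 (endIncl_bijective π hπ ρ)
  let j : LinearMap.ker ((inflH2 π ρ).comp (extensionMap τ' (exists_section τ' hτ') ρ)) →+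
      LinearMap.ker (extensionMap τ (exists_section τ hτ) (inflModule π ρ)) :=
    { toFun := fun φ => ⟨kerMapDual θ h.1 ρ φ.1, by
        have := φ.2
        rw [LinearMap.mem_ker, extensionMap_kerMapDual _ (exists_section τ' hτ')]
        exact this⟩
      map_zero' := rfl
      map_add' := fun _ _ => rfl }
  refine rank_le_of_injective_injective e j (fun r hr => ?_) (fun φ ψ hφψ => ?_)
    (fun r φ => Subtype.ext ?_)
  · rw [← he r, hr, map_zero]
  · exact Subtype.ext (kerMapDual_injective θ h ρ (congrArg Subtype.val hφψ))
  · change kerMapDual θ h.1 ρ (e r • φ.1) = r • kerMapDual θ h.1 ρ φ.1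
    rw [LinearMap.map_smulₛₗ, he]

/-- Conditions (b) and (c) give a compatible embedding of `Hom_{G'}(Ker τ', A)` in
`Hom_G(Ker τ, Inf_π A)`. -/
theorem exists_injective_kerDual (hτ : Function.Surjective τ)
    (hτ' : Function.Surjective τ') (hπ : Function.Surjective π)
    {ρ : Representation ℤ G' A} (hρ : IsFiniteSimple ρ)
    (hb : inflH2 π ρ '' (moduleSupp τ' hτ' ρ : Set (H2 ρ)) ⊆
      (moduleSupp τ hτ (inflModule π ρ) : Set (H2 (inflModule π ρ))))
    (hc : inflNullity π τ' hτ' ρ + moduleMult τ' hτ' ρ ≤ moduleMult τ hτ (inflModule π ρ)) :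
    ∃ l : kerDual τ' ρ →ₛₗ[endIncl π ρ] kerDual τ (inflModule π ρ), Function.Injective l ∧
      ∀ φ, extensionMap τ (exists_section τ hτ) (inflModule π ρ) (l φ) =
        inflH2 π ρ (extensionMap τ' (exists_section τ' hτ') ρ φ) := by
  have := hρ.nontrivial_endRing
  rw [inflNullity_add_moduleMult hτ' hρ, moduleMult_eq hτ (hρ.inflModule π hπ)] at hc
  rw [moduleSupp_eq hτ' hρ, moduleSupp_eq hτ (hρ.inflModule π hπ)] at hb
  exact exists_injective_lift hρ.isUnit_or_eq_zero (endIncl π ρ) (endIncl_bijective π hπ ρ)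
    ((inflH2 π ρ).comp (extensionMap τ' (exists_section τ' hτ') ρ)) _
    (fun φ => hb ⟨_, ⟨φ, rfl⟩, rfl⟩) hc

end Naturality

/-! ### Relations from equal cohomology classes. -/

section Relation

variable {H G H' G' A : Type u}
    [Group H] [TopologicalSpace H] [IsTopologicalGroup H]
    [CompactSpace H] [TotallyDisconnectedSpace H]
    [Group G] [TopologicalSpace G] [IsTopologicalGroup G]
    [CompactSpace G] [TotallyDisconnectedSpace G]
    [Group H'] [TopologicalSpace H'] [IsTopologicalGroup H']
    [CompactSpace H'] [TotallyDisconnectedSpace H']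
    [Group G'] [TopologicalSpace G'] [IsTopologicalGroup G']
    [CompactSpace G'] [TotallyDisconnectedSpace G'] [AddCommGroup A]
    {τ : H →ₜ* G} {τ' : H' →ₜ* G'} {π : G →ₜ* G'}

/-- The component in `Ker τ` of an element of `H`, with respect to a section of `τ`. -/
def kerPart (τ : H →ₜ* G) (s : G → H) (hs : ∀ g, τ (s g) = g) (h : H) : τ.toMonoidHom.ker :=
  ⟨h * (s (τ h))⁻¹, by
    change τ (h * (s (τ h))⁻¹) = 1
    rw [map_mul, map_inv, hs, mul_inv_cancel]⟩

lemma kerPart_mul (τ : H →ₜ* G) (s : G → H) (hs : ∀ g, τ (s g) = g) (x y : H) :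
    kerPart τ s hs (x * y) = kerPart τ s hs x *
      (MulAut.conjNormal (s (τ x)) (kerPart τ s hs y) * factorSet τ s hs (τ x, τ y)) := by
  apply Subtype.ext
  simp only [Subgroup.coe_mul, MulAut.conjNormal_apply, factorSet, kerPart, map_mul]
  group

lemma kerPart_of_mem (τ : H →ₜ* G) (s : G → H) (hs : ∀ g, τ (s g) = g)
    (k : τ.toMonoidHom.ker) : kerPart τ s hs k.1 = k * kerPart τ s hs 1 := by
  have hk : τ k.1 = 1 := k.2
  apply Subtype.ext
  change k.1 * (s (τ k.1))⁻¹ = k.1 * (1 * (s (τ 1))⁻¹)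
  rw [hk, map_one, one_mul]

lemma kerDual_kerPart_mul {ρ : Representation ℤ G A} (φ : kerDual τ ρ) (s : G → H)
    (hs : ∀ g, τ (s g) = g) (x y : H) :
    φ.1 (kerPart τ s hs (x * y)) = φ.1 (kerPart τ s hs x) +
      (ρ (τ x) (φ.1 (kerPart τ s hs y)) + φ.1 (factorSet τ s hs (τ x, τ y))) := by
  rw [kerPart_mul, kerDual_mul, kerDual_mul, kerDual_conj, hs]

/-- If `S ψ` is the inflation of `S φ`, then `ψ - φ` extends from `Ker τ × Ker τ'` to a crossed
homomorphism on `H ×_{G'} H'`. -/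
lemma exists_crossedHom {ρ : Representation ℤ G' A}
    (hτ : ∃ s : C(G, H), ∀ g, τ (s g) = g) (hτ' : ∃ s : C(G', H'), ∀ g, τ' (s g) = g)
    (φ : kerDual τ' ρ) (ψ : kerDual τ (inflModule π ρ))
    (h : extensionMap τ hτ (inflModule π ρ) ψ = inflH2 π ρ (extensionMap τ' hτ' ρ φ)) :
    ∃ d : overProduct τ τ' π → A, IsLocallyConstant d ∧
      (∀ p q, d (p * q) = d p + ρ (τ' p.1.2) (d q)) ∧
      ∀ (k : τ.toMonoidHom.ker) (k' : τ'.toMonoidHom.ker) (hkk : (k.1, k'.1) ∈ overProduct τ τ' π),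
        d ⟨_, hkk⟩ = ψ.1 k - φ.1 k' := by
  obtain ⟨s, hs⟩ := hτ
  obtain ⟨t, ht⟩ := hτ'
  rw [extensionMap_apply τ s hs, extensionMap_apply τ' t ht] at h
  change _ = Submodule.Quotient.mk (inflCocycles π ρ (cocycleMap τ' t ht ρ φ)) at h
  rw [Submodule.Quotient.eq] at h
  obtain ⟨c, hc, hcob⟩ := h
  have hcob : ∀ x y : G, ψ.1 (factorSet τ s hs (x, y)) - φ.1 (factorSet τ' t ht (π x, π y)) =
    ρ (π x) (c y) - c (x * y) + c x := hcob
  have hτc : Continuous τ := τ.continuous_toFun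
  have hτc' : Continuous τ' := τ'.continuous_toFun
  have hsc := s.continuous
  have htc := t.continuous
  -- The first two terms fail to form a crossed homomorphism by exactly the difference of the two
  -- cocycles; the cochain `c` with that coboundary corrects this.
  let d : overProduct τ τ' π → A := fun p =>
    ψ.1 (kerPart τ s hs p.1.1) - φ.1 (kerPart τ' t ht p.1.2) + c (τ p.1.1)
  have hd : ∀ p q, d (p * q) = d p + ρ (τ' p.1.2) (d q) := by
    intro p q
    have hp := mem_overProduct.1 p.2
    have hq := mem_overProduct.1 q.2
    have h1 := hcob (τ p.1.1) (τ q.1.1)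
    change ψ.1 (kerPart τ s hs (p.1.1 * q.1.1)) - φ.1 (kerPart τ' t ht (p.1.2 * q.1.2)) +
      c (τ (p.1.1 * q.1.1)) = d p + ρ (τ' p.1.2) (d q)
    rw [kerDual_kerPart_mul, kerDual_kerPart_mul, map_mul τ]
    have h2 : ∀ g a, inflModule π ρ g a = ρ (π g) a := fun _ _ => rfl
    rw [h2, hp]
    rw [hp, hq] at h1
    simp only [d, map_add, map_sub]
    rw [sub_eq_iff_eq_add] at h1
    rw [h1]
    abel
  refine ⟨d, ?_, hd, fun k k' hkk => ?_⟩
  · refine ((ψ.2.1.comp_continuous ?_).sub (φ.2.1.comp_continuous ?_)).add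
      (hc.comp_continuous ?_)
    · unfold kerPart; fun_prop
    · unfold kerPart; fun_prop
    · fun_prop
  -- The sections need not send `1` to `1`; the resulting constants add up to `d 1`, which vanishes.
  · have h1 : d 1 = 0 := by
      have := hd 1 1
      have h2 : ρ (τ' (1 : overProduct τ τ' π).1.2) (d 1) = d 1 := by
        change ρ (τ' 1) (d 1) = d 1
        rw [map_one, map_one]; rfl
      rwa [mul_one, h2, left_eq_add] at this
    have h3 : ψ.1 (kerPart τ s hs 1) - φ.1 (kerPart τ' t ht 1) + c (τ 1) = 0 := h1
    have hk : τ k.1 = 1 := k.2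
    change ψ.1 (kerPart τ s hs k.1) - φ.1 (kerPart τ' t ht k'.1) + c (τ k.1) = _
    rw [kerPart_of_mem, kerPart_of_mem, kerDual_mul, kerDual_mul, hk]
    rw [map_one] at h3
    have h4 : ψ.1 k + ψ.1 (kerPart τ s hs 1) - (φ.1 k' + φ.1 (kerPart τ' t ht 1)) + c 1 =
      (ψ.1 k - φ.1 k') + (ψ.1 (kerPart τ s hs 1) - φ.1 (kerPart τ' t ht 1) + c 1) := by abel
    rw [h4, h3, add_zero]

/-- The closed relation between `H` and `H'` that compares `H' / Ker φ` with `H / Ker ψ`. -/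
theorem exists_relation_of_kerDual {ρ : Representation ℤ G' A}
    (hτ : ∃ s : C(G, H), ∀ g, τ (s g) = g) (hτ' : ∃ s : C(G', H'), ∀ g, τ' (s g) = g)
    (φ : kerDual τ' ρ) (ψ : kerDual τ (inflModule π ρ)) (hφ : Function.Surjective φ.1)
    (hψ : Function.Surjective ψ.1)
    (h : extensionMap τ hτ (inflModule π ρ) ψ = inflH2 π ρ (extensionMap τ' hτ' ρ φ)) :
    ∃ R : Subgroup (H × H'), IsClosed (R : Set (H × H')) ∧
      (∀ p ∈ R, τ' p.2 = π (τ p.1)) ∧ (∀ h, ∃ h', (h, h') ∈ R) ∧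
      (∀ k' ∈ τ'.toMonoidHom.ker, ∃ k ∈ τ.toMonoidHom.ker, (k, k') ∈ R) ∧
      (∀ k ∈ dualKernel ψ, (k, 1) ∈ R) ∧ ∀ h', (1, h') ∈ R ↔ h' ∈ dualKernel φ := by
  obtain ⟨d, hdc, hd, hdk⟩ := exists_crossedHom hτ hτ' φ ψ h
  have h1 : d 1 = 0 := by
    have := hd 1 1
    have h2 : ρ (τ' (1 : overProduct τ τ' π).1.2) (d 1) = d 1 := by
      change ρ (τ' 1) (d 1) = d 1
      rw [map_one, map_one]; rfl
    rwa [mul_one, h2, left_eq_add] at this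
  -- The zero set of a crossed homomorphism is a subgroup. On `Ker τ × Ker τ'` it is the set where
  -- `ψ k = φ k'`.
  let R₀ : Subgroup (overProduct τ τ' π) :=
    { carrier := {p | d p = 0}
      one_mem' := h1
      mul_mem' := fun {p q} hp hq => by
        have hp : d p = 0 := hp
        have hq : d q = 0 := hq
        change d (p * q) = 0
        rw [hd, hp, hq, map_zero, add_zero]
      inv_mem' := fun {p} hp => by
        have hp : d p = 0 := hp
        have := hd p⁻¹ p
        rw [inv_mul_cancel, h1, hp, map_zero, add_zero] at this
        exact this.symm }
  have hmem : ∀ p, p ∈ R₀.map (overProduct τ τ' π).subtype ↔ ∃ hp, d ⟨p, hp⟩ = 0 := by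
    intro p
    constructor
    · rintro ⟨q, hq, rfl⟩; exact ⟨q.2, hq⟩
    · rintro ⟨hp, hp0⟩; exact ⟨⟨p, hp⟩, hp0, rfl⟩
  have hker : ∀ (k : τ.toMonoidHom.ker) (k' : τ'.toMonoidHom.ker),
      (k.1, k'.1) ∈ overProduct τ τ' π := fun k k' => by
    have hk : τ k.1 = 1 := k.2
    have hk' : τ' k'.1 = 1 := k'.2
    rw [mem_overProduct, hk, hk', map_one]
  have hmemk : ∀ (k : τ.toMonoidHom.ker) (k' : τ'.toMonoidHom.ker),
      (k.1, k'.1) ∈ R₀.map (overProduct τ τ' π).subtype ↔ ψ.1 k = φ.1 k' := fun k k' => by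
    rw [hmem, ← sub_eq_zero, ← hdk k k' (hker k k')]
    exact ⟨fun h => h.2, fun h => ⟨_, h⟩⟩
  refine ⟨R₀.map (overProduct τ τ' π).subtype, ?_, ?_, ?_, ?_, ?_, ?_⟩
  · have hcl : IsClosed {p | d p = 0} := hdc.isClosed_fiber 0
    exact (isClosed_overProduct τ τ' π).isClosedEmbedding_subtypeVal.isClosedMap _ hcl
  · intro p hp
    exact ((hmem p).1 hp).1.symm
  · intro y
    obtain ⟨s, hs⟩ := hτ'
    let p : overProduct τ τ' π := ⟨(y, s (π (τ y))), by rw [mem_overProduct, hs]⟩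
    -- Multiplying `p` on the left by `(1, k')` changes `d p` by `-φ k'`, so this `k'` brings it to
    -- zero.
    obtain ⟨k', hk'⟩ := hφ (d p)
    let q : overProduct τ τ' π := ⟨(1, k'.1), hker 1 k'⟩
    have hqp' : (y, k'.1 * s (π (τ y))) = (q * p).1 := by
      change _ = (1 * y, k'.1 * s (π (τ y)))
      rw [one_mul]
    refine ⟨k'.1 * s (π (τ y)), (hmem _).2 ⟨hqp' ▸ (q * p).2, ?_⟩⟩
    · have hqp : d (q * p) = 0 := by
        have hk1 : τ' k'.1 = 1 := k'.2
        rw [hd]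
        change d q + ρ (τ' k'.1) (d p) = 0
        have hq : d q = ψ.1 1 - φ.1 k' := hdk 1 k' _
        rw [hq, kerDual_one, hk', hk1, map_one, zero_sub]
        exact neg_add_cancel _
      rw [← hqp]
      exact congrArg d (Subtype.ext hqp')
  · intro k' hk'
    obtain ⟨k, hk⟩ := hψ (φ.1 ⟨k', hk'⟩)
    exact ⟨k.1, k.2, (hmemk k ⟨k', hk'⟩).2 hk⟩
  · rintro k ⟨hk, hk0⟩
    exact (hmemk ⟨k, hk⟩ 1).2 (by rw [hk0, kerDual_one])
  · intro h'
    constructor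
    · intro hh
      have hk' : h' ∈ τ'.toMonoidHom.ker := by
        have := mem_overProduct.1 ((hmem _).1 hh).1
        change τ' h' = 1
        rw [← this, map_one, map_one]
      refine ⟨hk', ?_⟩
      rw [← (hmemk 1 ⟨h', hk'⟩).1 hh, kerDual_one]
    · rintro ⟨hk', h0⟩
      exact (hmemk 1 ⟨h', hk'⟩).2 (by rw [h0, kerDual_one])

end Relation

/-! ### Maximal subgroups with abelian quotient. -/

section AbelianChief

variable {H G : Type u} [Group H] [TopologicalSpace H] [IsTopologicalGroup H]
  [CompactSpace H] [TotallyDisconnectedSpace H]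
  [Group G] [TopologicalSpace G] [IsTopologicalGroup G]
  [CompactSpace G] [TotallyDisconnectedSpace G]

/-- A maximal `N` is relatively open. -/
lemma IsMaximalNormalIn.exists_openNormalSubgroup {M N : Subgroup H} [M.Normal]
    (hMc : IsClosed (M : Set H)) (h : IsMaximalNormalIn M N) :
    ∃ U : OpenNormalSubgroup H, M ⊓ U.toSubgroup ≤ N := by
  have := h.normal
  obtain ⟨m, hm, hmN⟩ := SetLike.exists_of_lt h.lt
  have hO : IsOpen {x : H | m * x ∈ (N : Set H)ᶜ} :=
    h.isClosed.isOpen_compl.preimage (continuous_const_mul m)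
  obtain ⟨U, hU⟩ := ProfiniteGrp.exist_openNormalSubgroup_sub_open_nhds_of_one hO
    (by simpa using hmN)
  refine ⟨U, ?_⟩
  by_contra hle
  have hUn : U.toSubgroup.Normal := U.isNormal'
  have hUc : IsClosed (U.toSubgroup : Set H) := Subgroup.isClosed_of_isOpen _ U.isOpen'
  -- If `M ⊓ U` were not in `N`, the two would generate `M`, so the coset `m U` would meet `N`,
  -- against the choice of `U`.
  have hsup := h.sup_eq (D := M ⊓ U.toSubgroup) (hMc.inter hUc) inf_le_left hle
  rw [← hsup, sup_comm] at hm
  obtain ⟨n, hn, x, hx, rfl⟩ := Subgroup.mem_sup_of_normal_left.1 hm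
  exact hU (U.toSubgroup.inv_mem hx.2) (by simpa using hn)

/-- An abelian quotient of `Ker τ` as an abstract abelian group. -/
lemma IsMaximalNormalIn.exists_abelian_quotient {M N : Subgroup H} [M.Normal]
    (hMc : IsClosed (M : Set H)) (h : IsMaximalNormalIn M N)
    (hab : ∀ x ∈ M, ∀ y ∈ M, ⁅x, y⁆ ∈ N) :
    ∃ (A : Type u) (_ : AddCommGroup A) (f : M → A), Finite A ∧ Function.Surjective f ∧
      (∀ x y, f (x * y) = f x + f y) ∧ (∀ x, f x = 0 ↔ x.1 ∈ N) ∧ IsLocallyConstant f := by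
  have hNn := h.normal
  obtain ⟨U, hU⟩ := h.exists_openNormalSubgroup hMc
  have hUM : U.toSubgroup.subgroupOf M ≤ N.subgroupOf M := fun x hx => hU ⟨x.2, hx⟩
  have hUMo : IsOpen (U.toSubgroup.subgroupOf M : Set M) :=
    U.isOpen'.preimage continuous_subtype_val
  have hN'o : IsOpen (N.subgroupOf M : Set M) := Subgroup.isOpen_mono hUM hUMo
  have hMcs : CompactSpace M := isCompact_iff_compactSpace.1 hMc.isCompact
  have hfin : Finite (M ⧸ N.subgroupOf M) := Subgroup.quotient_finite_of_isOpen _ hN'o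
  let Q : CommGroup (M ⧸ N.subgroupOf M) :=
    { (inferInstance : Group (M ⧸ N.subgroupOf M)) with
      mul_comm := by
        intro x y
        obtain ⟨x, rfl⟩ := QuotientGroup.mk_surjective x
        obtain ⟨y, rfl⟩ := QuotientGroup.mk_surjective y
        refine QuotientGroup.eq.2 ?_
        have := hab y⁻¹ (M.inv_mem y.2) x⁻¹ (M.inv_mem x.2)
        rw [commutatorElement_def] at this
        change (x.1 * y.1)⁻¹ * (y.1 * x.1) ∈ N
        rw [mul_inv_rev]
        simpa [mul_assoc] using this }
  refine ⟨Additive (M ⧸ N.subgroupOf M), inferInstance,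
    fun x => Additive.ofMul (x : M ⧸ N.subgroupOf M), inferInstance, QuotientGroup.mk_surjective,
    fun _ _ => rfl, fun x => QuotientGroup.eq_one_iff x, ?_⟩
  have : DiscreteTopology (M ⧸ N.subgroupOf M) := QuotientGroup.discreteTopology hN'o
  have h1 : IsLocallyConstant (fun x : M => (x : M ⧸ N.subgroupOf M)) :=
    (IsLocallyConstant.iff_continuous _).2 continuous_quotient_mk'
  exact h1

/-- The action of `G` on an abelian quotient of `Ker τ`. -/
lemma exists_representation (τ : H →ₜ* G) (hτ : Function.Surjective τ) {N : Subgroup H}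
    [hN : N.Normal] {A : Type u} [AddCommGroup A] {f : τ.toMonoidHom.ker → A}
    (hf : Function.Surjective f) (hmul : ∀ x y, f (x * y) = f x + f y)
    (hzero : ∀ x, f x = 0 ↔ x.1 ∈ N) :
    ∃ ρ : Representation ℤ G A, ∀ (g : H) (x : τ.toMonoidHom.ker),
      ρ (τ g) (f x) = f (MulAut.conjNormal g x) := by
  have hone : f 1 = 0 := by
    have := hmul 1 1
    rwa [one_mul, left_eq_add] at this
  have hinv : ∀ x, f x⁻¹ = -f x := fun x => by
    have := hmul x⁻¹ x
    rw [inv_mul_cancel, hone] at this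
    exact eq_neg_of_add_eq_zero_left this.symm
  have key : ∀ (g : H) x y, f x = f y → f (MulAut.conjNormal g x) = f (MulAut.conjNormal g y) := by
    intro g x y hxy
    have h1 : f (x * y⁻¹) = 0 := by rw [hmul, hinv, hxy, add_neg_cancel]
    have h2 : f (MulAut.conjNormal g (x * y⁻¹)) = 0 :=
      (hzero _).2 (hN.conj_mem _ ((hzero _).1 h1) g)
    rw [map_mul, map_inv, hmul, hinv] at h2
    exact add_neg_eq_zero.1 h2
  -- Conjugation on the quotient depends only on `τ g`: two lifts differ by an element of `Ker τ`,
  -- which acts trivially because the quotient is abelian.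
  have key' : ∀ (g g' : H) x y, τ g = τ g' → f x = f y →
      f (MulAut.conjNormal g x) = f (MulAut.conjNormal g' y) := by
    intro g g' x y hg hxy
    have hk : τ (g' * g⁻¹) = 1 := by rw [map_mul, map_inv, hg, mul_inv_cancel]
    let k : τ.toMonoidHom.ker := ⟨g' * g⁻¹, hk⟩
    have h1 : MulAut.conjNormal g' y = k * MulAut.conjNormal g y * k⁻¹ := by
      refine Subtype.ext ?_
      change g' * y.1 * g'⁻¹ = g' * g⁻¹ * (g * y.1 * g⁻¹) * (g' * g⁻¹)⁻¹
      group
    rw [h1, hmul, hmul, hinv, key g x y hxy]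
    abel
  choose s hs using hf
  choose t ht using hτ
  let r : G → A →+ A := fun g => AddMonoidHom.mk' (fun a => f (MulAut.conjNormal (t g) (s a)))
    fun a b => by
      rw [← hmul, ← map_mul]
      exact key _ _ _ (by rw [hmul, hs, hs, hs])
  have hr : ∀ (g : H) x, r (τ g) (f x) = f (MulAut.conjNormal g x) := fun g x =>
    key' _ _ _ _ (ht _) (hs _)
  have hr1 : ∀ a, r 1 a = a := fun a => by
    have := hr 1 (s a)
    rwa [map_one, map_one, MulAut.one_apply, hs] at this
  have hrm : ∀ g g' a, r (g * g') a = r g (r g' a) := fun g g' a => by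
    have h1 := hr (t g * t g') (s a)
    have h2 := hr (t g') (s a)
    have h3 := hr (t g) (MulAut.conjNormal (t g') (s a))
    rw [map_mul, ht, ht, hs, map_mul, MulAut.mul_apply] at h1
    rw [ht, hs] at h2
    rw [ht] at h3
    rw [h1, h2, h3]
  exact ⟨{ toFun := fun g => (r g).toIntLinearMap
           map_one' := LinearMap.ext hr1
           map_mul' := fun g g' => LinearMap.ext (hrm g g') }, hr⟩

/-- The maximal subgroups of `Ker τ` with abelian quotient are the kernels of equivariant
homomorphisms to finite simple modules. -/
theorem exists_dualKernel_eq (τ : H →ₜ* G) (hτ : Function.Surjective τ) {N : Subgroup H}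
    (h : IsMaximalNormalIn τ.toMonoidHom.ker N)
    (hab : ∀ x ∈ τ.toMonoidHom.ker, ∀ y ∈ τ.toMonoidHom.ker, ⁅x, y⁆ ∈ N) :
    ∃ (A : Type u) (_ : AddCommGroup A) (ρ : Representation ℤ G A) (φ : kerDual τ ρ),
      IsFiniteSimple ρ ∧ dualKernel φ = N := by
  have hNn := h.normal
  obtain ⟨A, _, f, hfin, hf, hmul, hzero, hlc⟩ := h.exists_abelian_quotient (isClosed_ker τ) hab
  obtain ⟨ρ, hρ⟩ := exists_representation τ hτ hf hmul hzero
  refine ⟨A, inferInstance, ρ, ⟨f, hlc, hmul, fun e x => (hρ e x).symm⟩, ?_, ?_⟩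
  · refine ⟨hfin, fun a => ?_, ?_, fun B hB => ?_⟩
    · obtain ⟨x, rfl⟩ := hf a
      have hτc : Continuous τ := τ.continuous_toFun
      -- Continuity of the action of `G` is checked on `H`, of which `G` is a topological quotient.
      have hq := hτc.isClosedMap.isQuotientMap hτc hτ
      have hc : IsLocallyConstant fun g : H => f (MulAut.conjNormal g x) := by
        refine hlc.comp_continuous (Continuous.subtype_mk (p := (· ∈ τ.toMonoidHom.ker))
          (f := fun g : H => g * x.1 * g⁻¹) ?_ _)
        fun_prop
      intro V
      rw [← hq.isOpen_preimage]
      convert hc V using 1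
      ext g
      exact iff_of_eq (congrArg (· ∈ V) (hρ g x))
    · obtain ⟨m, hm, hmN⟩ := SetLike.exists_of_lt h.lt
      exact ⟨f ⟨m, hm⟩, 0, fun h0 => hmN ((hzero _).1 h0)⟩
    · have hadd : ∀ x, f x⁻¹ = -f x := fun x => by
        have h0 : f 1 = 0 := (hzero 1).2 N.one_mem
        have := hmul x⁻¹ x
        rw [inv_mul_cancel, h0] at this
        exact eq_neg_of_add_eq_zero_left this.symm
      -- The preimage of a submodule is a closed normal subgroup of `H` between `N` and `Ker τ`;
      -- maximality of `N` gives simplicity.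
      let L' : Subgroup τ.toMonoidHom.ker :=
        { carrier := {x | f x ∈ B}
          one_mem' := by
            change f 1 ∈ B
            rw [(hzero 1).2 N.one_mem]
            exact B.zero_mem
          mul_mem' := fun {x y} hx hy => by
            change f (x * y) ∈ B
            rw [hmul]
            exact B.add_mem hx hy
          inv_mem' := fun {x} hx => by
            change f x⁻¹ ∈ B
            rw [hadd]
            exact B.neg_mem hx }
      have hL'c : IsClosed (L' : Set τ.toMonoidHom.ker) := isOpen_compl_iff.1 (hlc (B : Set A)ᶜ)
      let L : Subgroup H := L'.map τ.toMonoidHom.ker.subtype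
      have hLM : L ≤ τ.toMonoidHom.ker := by
        rintro _ ⟨x, -, rfl⟩; exact x.2
      have hLc : IsClosed (L : Set H) :=
        (isClosed_ker τ).isClosedEmbedding_subtypeVal.isClosedMap _ hL'c
      have hmemL : ∀ x : τ.toMonoidHom.ker, x.1 ∈ L ↔ f x ∈ B := fun x =>
        ⟨fun ⟨y, hy, hyx⟩ => by
          have : y = x := Subtype.ext hyx
          rwa [← this], fun hx => ⟨x, hx, rfl⟩⟩
      have hLn : L.Normal := ⟨by
        rintro _ ⟨x, hx, rfl⟩ g
        refine ⟨MulAut.conjNormal g x, ?_, rfl⟩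
        change f _ ∈ B
        rw [← hρ]
        exact hB _ _ hx⟩
      by_cases hLe : L = τ.toMonoidHom.ker
      · right
        rw [eq_top_iff]
        intro a _
        obtain ⟨x, rfl⟩ := hf a
        exact (hmemL x).1 (hLe.symm.le x.2)
      · left
        rw [eq_bot_iff]
        intro a ha
        obtain ⟨x, rfl⟩ := hf a
        refine (hzero x).2 (h.2 ⟨hLn, hLc, lt_of_le_of_ne hLM hLe⟩ ?_ ((hmemL x).2 ha))
        intro n hn
        refine (hmemL ⟨n, h.lt.le hn⟩).2 ?_
        rw [(hzero ⟨n, h.lt.le hn⟩).2 hn]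
        exact B.zero_mem
  · ext x
    constructor
    · rintro ⟨hx, hx0⟩; exact (hzero ⟨x, hx⟩).1 hx0
    · intro hx; exact ⟨h.lt.le hx, (hzero ⟨x, h.lt.le hx⟩).2 hx⟩

end AbelianChief

/-! ### Isomorphisms of covers and profinite quotients. -/

section CoverIso

variable {H E D G : Type u} [Group H] [TopologicalSpace H] [Group E] [TopologicalSpace E]
  [Group D] [TopologicalSpace D] [Group G] [TopologicalSpace G]

lemma CoverIso.refl (ζ : E →ₜ* G) : CoverIso ζ ζ := ⟨ContinuousMulEquiv.refl E, fun _ => rfl⟩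

lemma CoverIso.symm {η : H →ₜ* G} {ζ : E →ₜ* G} (h : CoverIso η ζ) : CoverIso ζ η := by
  obtain ⟨e, he⟩ := h
  exact ⟨e.symm, fun x => by rw [← he, e.apply_symm_apply]⟩

lemma CoverIso.trans {η : H →ₜ* G} {ζ : E →ₜ* G} {ξ : D →ₜ* G} (h : CoverIso η ζ)
    (h' : CoverIso ζ ξ) : CoverIso η ξ := by
  obtain ⟨e, he⟩ := h
  obtain ⟨e', he'⟩ := h'
  exact ⟨e.trans e', fun x => (he' _).trans (he x)⟩

/-- Quotients isomorphic to `ζ` are handled as kernels of epimorphisms `H → D` over `G`. Conversely,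
the induced continuous bijection from compact `H/M` to the Hausdorff `D` is a homeomorphism. -/
lemma mem_coverQuotients_iff [IsTopologicalGroup H] [CompactSpace H] [TotallyDisconnectedSpace H]
    [T2Space D] {τ : H →ₜ* G} {ζ : D →ₜ* G} {M : Subgroup H} :
    M ∈ coverQuotients τ ζ ↔ ∃ f : H →ₜ* D, Function.Surjective f ∧ (∀ h, ζ (f h) = τ h) ∧
      ∀ h, h ∈ M ↔ f h = 1 := by
  constructor
  · rintro ⟨_, hM, hMc, e, he⟩
    refine ⟨{ toMonoidHom := e.toMulEquiv.toMonoidHom.comp (QuotientGroup.mk' M),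
              continuous_toFun := e.continuous_toFun.comp continuous_quotient_mk' },
      e.surjective.comp QuotientGroup.mk_surjective, fun h => he h, fun h => ?_⟩
    change _ ↔ e (h : H ⧸ M) = 1
    rw [← QuotientGroup.eq_one_iff]
    exact (map_eq_one_iff e e.injective).symm
  · rintro ⟨f, hf, hfζ, hM⟩
    have hMk : M = f.toMonoidHom.ker := Subgroup.ext hM
    subst hMk
    have hcl : IsClosed (f.toMonoidHom.ker : Set H) :=
      isClosed_singleton.preimage f.continuous_toFun
    refine ⟨inferInstance, fun h hh => ?_, hcl, ?_⟩
    · have hh : f h = 1 := hh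
      change τ h = 1
      rw [← hfζ, hh, map_one]
    · let e : H ⧸ f.toMonoidHom.ker ≃* D :=
        QuotientGroup.quotientKerEquivOfSurjective f.toMonoidHom hf
      have hec : Continuous e := Continuous.quotient_lift f.continuous_toFun _
      refine ⟨{ toMulEquiv := e, continuous_toFun := hec,
                continuous_invFun := (hec.homeoOfEquivCompactToT2 (f := e.toEquiv)).symm.continuous },
        fun q => ?_⟩
      obtain ⟨h, rfl⟩ := QuotientGroup.mk_surjective q
      exact hfζ h

end CoverIso

/-- Images of open normal subgroups are clopen and separate the cosets of a closed `N`. This makes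
`H'/N` a profinite group, to which condition (a) can be applied. -/
lemma totallyDisconnectedSpace_quotient {H : Type u} [Group H] [TopologicalSpace H]
    [IsTopologicalGroup H] [CompactSpace H] [TotallyDisconnectedSpace H] (N : Subgroup H)
    [N.Normal] (hN : IsClosed (N : Set H)) : TotallyDisconnectedSpace (H ⧸ N) := by
  have : TotallySeparatedSpace (H ⧸ N) := by
    rw [totallySeparatedSpace_iff_exists_isClopen]
    intro x y hxy
    obtain ⟨a, rfl⟩ := QuotientGroup.mk_surjective x
    obtain ⟨b, rfl⟩ := QuotientGroup.mk_surjective y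
    have hab : a⁻¹ * b ∉ N := fun h => hxy (QuotientGroup.eq.2 h)
    have hO : IsOpen {x : H | a⁻¹ * b * x ∈ (N : Set H)ᶜ} :=
      hN.isOpen_compl.preimage (continuous_const_mul _)
    obtain ⟨U, hU⟩ := ProfiniteGrp.exist_openNormalSubgroup_sub_open_nhds_of_one hO
      (by simpa using hab)
    let V : Subgroup (H ⧸ N) := U.toSubgroup.map (QuotientGroup.mk' N)
    have hVo : IsOpen (V : Set (H ⧸ N)) := QuotientGroup.isOpenMap_coe _ U.isOpen'
    refine ⟨{q | (a : H ⧸ N)⁻¹ * q ∈ V}, ⟨?_, ?_⟩, ?_, ?_⟩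
    · exact (Subgroup.isClosed_of_isOpen V hVo).preimage (continuous_const_mul _)
    · exact hVo.preimage (continuous_const_mul _)
    · change (a : H ⧸ N)⁻¹ * a ∈ V
      rw [inv_mul_cancel]; exact V.one_mem
    · rintro ⟨u, hu, hu'⟩
      have hu' : (u : H ⧸ N) = ((a⁻¹ * b : H) : H ⧸ N) := hu'
      have h1 : (a⁻¹ * b)⁻¹ * u ∈ N := QuotientGroup.eq.1 hu'.symm
      refine hU (U.toSubgroup.inv_mem hu) ?_
      have h2 : a⁻¹ * b * u⁻¹ ∈ N := by
        have hn : N.Normal := inferInstance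
        have := hn.conj_mem _ (N.inv_mem h1) (a⁻¹ * b)
        simpa [mul_assoc] using this
      exact h2
  infer_instance

/-! ### Non-abelian quotients and condition (a). -/

section Chief

variable {H G H' G' : Type u}
    [Group H] [TopologicalSpace H] [IsTopologicalGroup H]
    [CompactSpace H] [TotallyDisconnectedSpace H]
    [Group G] [TopologicalSpace G] [IsTopologicalGroup G]
    [CompactSpace G] [TotallyDisconnectedSpace G]
    [Group H'] [TopologicalSpace H'] [IsTopologicalGroup H']
    [CompactSpace H'] [TotallyDisconnectedSpace H']
    [Group G'] [TopologicalSpace G'] [IsTopologicalGroup G']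
    [CompactSpace G'] [TotallyDisconnectedSpace G']
    {τ : H →ₜ* G} {τ' : H' →ₜ* G'} {π : G →ₜ* G'}

/-- Condition (a) is necessary. -/
theorem IsSemiCartesian.coverMult_le (hτ : Function.Surjective τ) {θ : H →ₜ* H'}
    (h : IsSemiCartesian θ τ τ' π) {E : Type u} [Group E] [TopologicalSpace E]
    [IsTopologicalGroup E] [CompactSpace E] [TotallyDisconnectedSpace E] (ζ : E →ₜ* G') :
    coverMult τ' ζ ≤ coverMult τ (inflCover π ζ) := by
  have hmem : ∀ N ∈ coverQuotients τ' ζ,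
      N.comap θ.toMonoidHom ⊓ τ.toMonoidHom.ker ∈ coverQuotients τ (inflCover π ζ) := by
    intro N hN
    obtain ⟨g, hg, hgζ, hgN⟩ := mem_coverQuotients_iff.1 hN
    have hmem : ∀ x, (τ x, g (θ x)) ∈ fiberProduct π ζ := fun x => by
      change π (τ x) = ζ (g (θ x))
      rw [hgζ, h.1]
    -- The kernel of this map is `θ⁻¹(N) ⊓ Ker τ`, and `θ(Ker τ) = Ker τ'` makes it onto.
    let f : H →ₜ* fiberProduct π ζ :=
      { toFun := fun x => ⟨(τ x, g (θ x)), hmem x⟩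
        map_one' := Subtype.ext (Prod.ext (map_one τ) (by
          change g (θ 1) = 1
          rw [map_one, map_one]))
        map_mul' := fun x y => Subtype.ext (Prod.ext (map_mul τ x y) (by
          change g (θ (x * y)) = g (θ x) * g (θ y)
          rw [map_mul, map_mul]))
        continuous_toFun := (τ.continuous_toFun.prodMk
          (g.continuous_toFun.comp θ.continuous_toFun)).subtype_mk hmem }
    have hf : ∀ x, (f x).1 = (τ x, g (θ x)) := fun _ => rfl
    refine mem_coverQuotients_iff.2 ⟨f, ?_, fun _ => rfl, fun x => ?_⟩
    · rintro ⟨⟨a, e⟩, hae⟩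
      have hae : π a = ζ e := hae
      obtain ⟨x, rfl⟩ := hτ a
      obtain ⟨y, hy⟩ := hg ((g (θ x))⁻¹ * e)
      have hyK : y ∈ τ'.toMonoidHom.ker := by
        change τ' y = 1
        rw [← hgζ, hy, map_mul, map_inv, hgζ, h.1, hae, inv_mul_cancel]
      rw [← h.2] at hyK
      obtain ⟨k, hk, rfl⟩ := hyK
      have hk1 : τ k = 1 := hk
      have hy : g (θ k) = (g (θ x))⁻¹ * e := hy
      refine ⟨x * k, Subtype.ext ?_⟩
      rw [hf, map_mul, map_mul, map_mul, hk1, hy, mul_one, mul_inv_cancel_left]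
    · rw [Subtype.ext_iff, hf, Subgroup.mem_inf, Subgroup.mem_comap]
      change θ x ∈ N ∧ τ x = 1 ↔ (τ x, g (θ x)) = (1, 1)
      rw [hgN, Prod.mk.injEq, and_comm]
  refine Cardinal.mk_le_of_injective (f := fun N : coverQuotients τ' ζ =>
    (⟨_, hmem N.1 N.2⟩ : coverQuotients τ (inflCover π ζ))) ?_
  have hrec : ∀ N ∈ coverQuotients τ' ζ,
      (N.comap θ.toMonoidHom ⊓ τ.toMonoidHom.ker).map θ.toMonoidHom = N := by
    rintro N ⟨_, hN, -⟩
    ext y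
    constructor
    · rintro ⟨x, hx, rfl⟩; exact hx.1
    · intro hy
      have hyK := hN hy
      rw [← h.2] at hyK
      obtain ⟨k, hk, rfl⟩ := hyK
      exact ⟨k, ⟨hy, hk⟩, rfl⟩
  intro N N' hNN
  refine Subtype.ext ?_
  rw [← hrec _ N.2, ← hrec _ N'.2]
  exact congrArg (Subgroup.map θ.toMonoidHom) (congrArg Subtype.val hNN)

/-- A quotient of `τ` that is isomorphic to an inflated cover, as a homomorphism over `π`. -/
lemma exists_hom_of_mem_coverQuotients {E : Type u} [Group E]
    [TopologicalSpace E] [IsTopologicalGroup E] [CompactSpace E] [TotallyDisconnectedSpace E]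
    {ζ : E →ₜ* G'} {M : Subgroup H} (hM : M ∈ coverQuotients τ (inflCover π ζ)) :
    ∃ f : H →ₜ* E, (∀ h, ζ (f h) = π (τ h)) ∧
      (∀ e, ζ e = 1 → ∃ k ∈ τ.toMonoidHom.ker, f k = e) ∧
      ∀ k ∈ τ.toMonoidHom.ker, k ∈ M ↔ f k = 1 := by
  obtain ⟨f, hf, hfτ, hfM⟩ := mem_coverQuotients_iff.1 hM
  have hfτ : ∀ h, (f h).1.1 = τ h := hfτ
  refine ⟨{ toFun := fun h => (f h).1.2
            map_one' := by rw [map_one]; rfl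
            map_mul' := fun x y => by rw [map_mul]; rfl
            continuous_toFun := continuous_snd.comp
              (continuous_subtype_val.comp f.continuous_toFun) }, fun h => ?_, fun e he => ?_,
    fun k hk => ?_⟩
  · have h1 : π (f h).1.1 = ζ (f h).1.2 := (f h).2
    rw [hfτ] at h1
    exact h1.symm
  · obtain ⟨k, hk⟩ := hf ⟨(1, e), by
      change π 1 = ζ e
      rw [map_one, he]⟩
    refine ⟨k, ?_, congrArg (fun p => p.1.2) hk⟩
    change τ k = 1
    rw [← hfτ, hk]
  · have hk : τ k = 1 := hk
    rw [hfM, Subtype.ext_iff, Prod.ext_iff, hfτ, hk]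
    exact ⟨fun h => h.2, fun h => ⟨rfl, h⟩⟩

/-- The maximal normal subgroups in `Ker τ` with non-abelian quotient. -/
abbrev NonabelianChief (τ : H →ₜ* G) : Type u :=
  {N : Subgroup H // IsMaximalNormalIn τ.toMonoidHom.ker N ∧
    ∃ x ∈ τ.toMonoidHom.ker, ∃ y ∈ τ.toMonoidHom.ker, ⁅x, y⁆ ∉ N}

instance (N : NonabelianChief τ) : N.1.Normal := N.2.1.normal

instance (N : NonabelianChief τ) : IsClosed (N.1 : Set H) := N.2.1.isClosed

instance (N : NonabelianChief τ) : TotallyDisconnectedSpace (H ⧸ N.1) :=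
  totallyDisconnectedSpace_quotient N.1 N.2.1.isClosed

/-- The cover `H/N → G`. -/
def chiefCover (N : NonabelianChief τ) : H ⧸ N.1 →ₜ* G := inducedMap τ N.1 N.2.1.lt.le

lemma chiefCover_mk (N : NonabelianChief τ) (h : H) : chiefCover N (h : H ⧸ N.1) = τ h := rfl

lemma hasNonabelianKernel_chiefCover (N : NonabelianChief τ) :
    HasNonabelianKernel (chiefCover N) := by
  obtain ⟨x, hx, y, hy, hxy⟩ := N.2.2
  refine ⟨(x : H ⧸ N.1), hx, (y : H ⧸ N.1), hy, fun h => hxy ?_⟩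
  rw [← QuotientGroup.eq_one_iff]
  exact commutatorElement_eq_one_iff_mul_comm.2 h

/-- A factorization through `D` yields a closed normal subgroup between `N` and `Ker τ`, which must
be one of the two by maximality. -/
lemma isIndecomposable_chiefCover (hτ : Function.Surjective τ) (N : NonabelianChief τ) :
    IsIndecomposable (chiefCover N) := by
  refine ⟨fun g => ?_, fun hb => ?_, ?_⟩
  · obtain ⟨h, rfl⟩ := hτ g
    exact ⟨(h : H ⧸ N.1), rfl⟩
  · obtain ⟨m, hm, hmN⟩ := SetLike.exists_of_lt N.2.1.lt
    refine hmN ((QuotientGroup.eq_one_iff m).1 (hb.1 ?_))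
    rw [chiefCover_mk, map_one]
    exact hm
  · intro D _ _ _ _ _ ψ ρ hψ hρ hρψ
    let L : Subgroup H := (ψ.toMonoidHom.comp (QuotientGroup.mk' N.1)).ker
    have hmemL : ∀ h, h ∈ L ↔ ψ (h : H ⧸ N.1) = 1 := fun _ => Iff.rfl
    have hLc : IsClosed (L : Set H) :=
      isClosed_singleton.preimage (ψ.continuous_toFun.comp continuous_quotient_mk')
    have hNL : N.1 ≤ L := fun n hn => by
      rw [hmemL, (QuotientGroup.eq_one_iff n).2 hn, map_one]
    have hLK : L ≤ τ.toMonoidHom.ker := fun l hl => by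
      change τ l = 1
      rw [← chiefCover_mk N l, ← hρψ, (hmemL l).1 hl, map_one]
    by_cases hLe : L = τ.toMonoidHom.ker
    · right
      refine ⟨?_, hρ⟩
      rw [injective_iff_map_eq_one]
      intro d hd
      obtain ⟨q, rfl⟩ := hψ d
      obtain ⟨h, rfl⟩ := QuotientGroup.mk_surjective q
      rw [hρψ] at hd
      exact (hmemL h).1 (hLe.symm.le hd)
    · left
      refine ⟨?_, hψ⟩
      rw [injective_iff_map_eq_one]
      intro q hq
      obtain ⟨h, rfl⟩ := QuotientGroup.mk_surjective q
      exact (QuotientGroup.eq_one_iff h).2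
        (N.2.1.2 ⟨inferInstance, hLc, lt_of_le_of_ne hLK hLe⟩ hNL ((hmemL h).2 hq))

/-- The kernel of an indecomposable cover with non-abelian kernel has trivial centre. -/
lemma chiefCover_center (N : NonabelianChief τ) (z : H ⧸ N.1) (hz : chiefCover N z = 1)
    (hcomm : ∀ w, chiefCover N w = 1 → z * w = w * z) : z = 1 := by
  obtain ⟨z, rfl⟩ := QuotientGroup.mk_surjective z
  let S : Subgroup (H ⧸ N.1) := (chiefCover N).toMonoidHom.ker
  -- The preimage of the centre of the kernel lies between `N` and `Ker τ`, and is not `Ker τ` as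
  -- the kernel is non-abelian; so it is `N`.
  let Z : Subgroup H := τ.toMonoidHom.ker ⊓ (Subgroup.centralizer (S : Set (H ⧸ N.1))).comap
    (QuotientGroup.mk' N.1)
  have hmemZ : ∀ h, h ∈ Z ↔ τ h = 1 ∧ ∀ w, chiefCover N w = 1 → w * h = h * w := fun h => Iff.rfl
  have hZn : Z.Normal := inferInstance
  have hZc : IsClosed (Z : Set H) :=
    (isClosed_ker τ).inter ((Set.isClosed_centralizer (S : Set (H ⧸ N.1))).preimage
      continuous_quotient_mk')
  have hNZ : N.1 ≤ Z := fun n hn => by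
    rw [hmemZ, (QuotientGroup.eq_one_iff n).2 hn]
    exact ⟨N.2.1.lt.le hn, fun w _ => by rw [mul_one, one_mul]⟩
  have hZne : Z ≠ τ.toMonoidHom.ker := by
    intro h
    obtain ⟨x, hx, y, hy, hxy⟩ := hasNonabelianKernel_chiefCover N
    obtain ⟨y, rfl⟩ := QuotientGroup.mk_surjective y
    exact hxy (((hmemZ y).1 (h.symm.le hy)).2 x hx)
  exact (QuotientGroup.eq_one_iff z).2 (N.2.1.2 ⟨hZn, hZc, lt_of_le_of_ne inf_le_left hZne⟩ hNZ
    ((hmemZ z).2 ⟨hz, fun w hw => (hcomm w hw).symm⟩))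

/-- `f : H → H'/N` is a homomorphism over `π` that maps `Ker τ` onto the kernel of `H'/N → G'`,
with kernel `M` there. -/
structure IsChiefLift (π : G →ₜ* G') (τ : H →ₜ* G) (N : NonabelianChief τ') (M : Subgroup H)
    (f : H →ₜ* H' ⧸ N.1) : Prop where
  comm : ∀ h, chiefCover N (f h) = π (τ h)
  exists_mem_ker : ∀ q, chiefCover N q = 1 → ∃ k ∈ τ.toMonoidHom.ker, f k = q
  le_ker : M ≤ τ.toMonoidHom.ker
  mem_iff : ∀ k ∈ τ.toMonoidHom.ker, k ∈ M ↔ f k = 1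

namespace IsChiefLift

variable {N : NonabelianChief τ'} {M : Subgroup H} {f : H →ₜ* H' ⧸ N.1}

lemma eq_inf (h : IsChiefLift π τ N M f) : M = τ.toMonoidHom.ker ⊓ f.toMonoidHom.ker := by
  ext k
  exact ⟨fun hk => ⟨h.le_ker hk, (h.mem_iff k (h.le_ker hk)).1 hk⟩,
    fun hk => (h.mem_iff k hk.1).2 hk.2⟩

lemma surjective (h : IsChiefLift π τ N M f) (hτ : Function.Surjective τ)
    (hπ : Function.Surjective π) : Function.Surjective f := by
  intro q
  obtain ⟨g, hg⟩ := hπ (chiefCover N q)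
  obtain ⟨x, rfl⟩ := hτ g
  obtain ⟨k, -, hk⟩ := h.exists_mem_ker ((f x)⁻¹ * q) (by
    rw [map_mul, map_inv, h.comm, hg, inv_mul_cancel])
  exact ⟨x * k, by rw [map_mul, hk, mul_inv_cancel_left]⟩

lemma exists_commutator_notMem (h : IsChiefLift π τ N M f) :
    ∃ x ∈ τ.toMonoidHom.ker, ∃ y ∈ τ.toMonoidHom.ker, ⁅x, y⁆ ∉ M := by
  obtain ⟨x, hx, y, hy, hxy⟩ := hasNonabelianKernel_chiefCover N
  obtain ⟨k, hk, rfl⟩ := h.exists_mem_ker x hx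
  obtain ⟨l, hl, rfl⟩ := h.exists_mem_ker y hy
  refine ⟨k, hk, l, hl, fun hkl => hxy ?_⟩
  have := (h.mem_iff _ (h.le_ker hkl)).1 hkl
  rw [map_commutatorElement] at this
  exact commutatorElement_eq_one_iff_mul_comm.1 this

/-- A subgroup `L` strictly between `M` and `Ker τ` would be carried by `f` to one strictly between
`N` and `Ker τ'`. Normality of the image uses that `f` is onto; `M ≠ Ker τ` holds because the
quotient is non-abelian. -/
lemma isMaximalNormalIn (h : IsChiefLift π τ N M f) (hτ : Function.Surjective τ)
    (hπ : Function.Surjective π) : IsMaximalNormalIn τ.toMonoidHom.ker M := by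
  have hMn : M.Normal := by rw [h.eq_inf]; infer_instance
  have hMc : IsClosed (M : Set H) := by
    rw [h.eq_inf]
    exact (isClosed_ker τ).inter (isClosed_singleton.preimage f.continuous_toFun)
  refine ⟨⟨hMn, hMc, lt_of_le_of_ne h.le_ker fun he => ?_⟩, ?_⟩
  · obtain ⟨x, hx, y, hy, hxy⟩ := h.exists_commutator_notMem
    refine hxy (he.symm.le ?_)
    exact Subgroup.commutator_le_left _ _ (Subgroup.commutator_mem_commutator hx hy)
  · rintro L ⟨hLn, hLc, hLlt⟩ hML l hl
    let P : Subgroup H' := (L.map f.toMonoidHom).comap (QuotientGroup.mk' N.1)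
    have hmemP : ∀ x : H', x ∈ P ↔ ∃ y ∈ L, f y = (x : H' ⧸ N.1) := fun _ => Iff.rfl
    have hPn : P.Normal := (hLn.map f.toMonoidHom (h.surjective hτ hπ)).comap _
    have hPc : IsClosed (P : Set H') :=
      ((hLc.isCompact.image f.continuous_toFun).isClosed).preimage continuous_quotient_mk'
    have hNP : N.1 ≤ P := fun n hn =>
      (hmemP n).2 ⟨1, L.one_mem, by rw [map_one, (QuotientGroup.eq_one_iff n).2 hn]⟩
    have hPK : P ≤ τ'.toMonoidHom.ker := fun x hx => by
      obtain ⟨y, hy, hyx⟩ := (hmemP x).1 hx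
      have hy1 : τ y = 1 := hLlt.le hy
      change τ' x = 1
      rw [← chiefCover_mk N, ← hyx, h.comm, hy1, map_one]
    have hPne : P ≠ τ'.toMonoidHom.ker := by
      intro he
      refine hLlt.not_ge fun k hk => ?_
      obtain ⟨x, hx⟩ := QuotientGroup.mk_surjective (f k)
      have hk1 : τ k = 1 := hk
      have hxP : x ∈ P := he.symm.le (by
        change τ' x = 1
        rw [← chiefCover_mk N, hx, h.comm, hk1, map_one])
      obtain ⟨y, hy, hyx⟩ := (hmemP x).1 hxP
      have h1 : y⁻¹ * k ∈ M := (h.mem_iff _ (mul_mem (inv_mem (hLlt.le hy)) hk)).2 (by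
        rw [map_mul, map_inv, hyx, hx, inv_mul_cancel])
      have := L.mul_mem hy (hML h1)
      rwa [mul_inv_cancel_left] at this
    obtain ⟨x, hx⟩ := QuotientGroup.mk_surjective (f l)
    have hxN := N.2.1.2 ⟨hPn, hPc, lt_of_le_of_ne hPK hPne⟩ hNP ((hmemP x).2 ⟨l, hl, hx.symm⟩)
    refine (h.mem_iff l (hLlt.le hl)).2 ?_
    rw [← hx, (QuotientGroup.eq_one_iff x).2 hxN]

/-- The kernel of `H'/N → G'` has trivial centre, so an element of it is trivial once it commutes
with the whole kernel. Thus `M` alone determines the kernel of `f` on all of `H`, which is why one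
`M` cannot serve two non-isomorphic covers. -/
lemma apply_eq_one_iff (h : IsChiefLift π τ N M f) (x : H) :
    f x = 1 ↔ π (τ x) = 1 ∧ ∀ k ∈ τ.toMonoidHom.ker, ⁅x, k⁆ ∈ M := by
  have hcK : ∀ k ∈ τ.toMonoidHom.ker, ⁅x, k⁆ ∈ τ.toMonoidHom.ker := fun k hk =>
    mul_mem ((MonoidHom.normal_ker τ.toMonoidHom).conj_mem k hk x) (inv_mem hk)
  constructor
  · intro hx
    refine ⟨by rw [← h.comm, hx, map_one], fun k hk => (h.mem_iff _ (hcK k hk)).2 ?_⟩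
    rw [map_commutatorElement, hx, commutatorElement_one_left]
  · rintro ⟨hx, hk⟩
    refine chiefCover_center N _ (by rw [h.comm, hx]) fun w hw => ?_
    obtain ⟨k, hkK, rfl⟩ := h.exists_mem_ker w hw
    have := (h.mem_iff _ (hcK k hkK)).1 (hk k hkK)
    rw [map_commutatorElement] at this
    exact commutatorElement_eq_one_iff_mul_comm.1 this

/-- The cover `H'/N → G'` is determined by `M`. -/
lemma coverIso (h : IsChiefLift π τ N M f) (hτ : Function.Surjective τ)
    (hπ : Function.Surjective π) {N₂ : NonabelianChief τ'} {f₂ : H →ₜ* H' ⧸ N₂.1}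
    (h₂ : IsChiefLift π τ N₂ M f₂) : CoverIso (chiefCover N) (chiefCover N₂) := by
  have h1 : f.toMonoidHom.ker ∈ coverQuotients (π.comp τ) (chiefCover N) :=
    mem_coverQuotients_iff.2 ⟨f, h.surjective hτ hπ, h.comm, fun _ => Iff.rfl⟩
  have h2 : f.toMonoidHom.ker ∈ coverQuotients (π.comp τ) (chiefCover N₂) :=
    mem_coverQuotients_iff.2 ⟨f₂, h₂.surjective hτ hπ, h₂.comm, fun x => by
      rw [h₂.apply_eq_one_iff, ← h.apply_eq_one_iff]; rfl⟩
  obtain ⟨_, _, _, h1⟩ := h1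
  obtain ⟨_, _, _, h2⟩ := h2
  exact h1.symm.trans h2

/-- The closed relation between `H` and `H'` given by `H → H'/N`. -/
lemma exists_relation (h : IsChiefLift π τ N M f) :
    ∃ R : Subgroup (H × H'), IsClosed (R : Set (H × H')) ∧
      (∀ p ∈ R, τ' p.2 = π (τ p.1)) ∧ (∀ h, ∃ h', (h, h') ∈ R) ∧
      (∀ k' ∈ τ'.toMonoidHom.ker, ∃ k ∈ τ.toMonoidHom.ker, (k, k') ∈ R) ∧
      (∀ k ∈ M, (k, 1) ∈ R) ∧ ∀ h', (1, h') ∈ R ↔ h' ∈ N.1 := by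
  let R : Subgroup (H × H') := (f.toMonoidHom.comp (MonoidHom.fst H H')).eqLocus
    ((QuotientGroup.mk' N.1).comp (MonoidHom.snd H H'))
  have hR : ∀ p : H × H', p ∈ R ↔ f p.1 = (p.2 : H' ⧸ N.1) := fun _ => Iff.rfl
  refine ⟨R, ?_, fun p hp => ?_, fun x => ?_, fun k' hk' => ?_, fun k hk => ?_, fun h' => ?_⟩
  · exact isClosed_eq (f.continuous_toFun.comp continuous_fst)
      (continuous_quotient_mk'.comp continuous_snd)
  · rw [← h.comm, (hR p).1 hp, chiefCover_mk]
  · obtain ⟨y, hy⟩ := QuotientGroup.mk_surjective (f x)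
    exact ⟨y, hy.symm⟩
  · obtain ⟨k, hk, hkf⟩ := h.exists_mem_ker (k' : H' ⧸ N.1) hk'
    exact ⟨k, hk, hkf⟩
  · exact (h.mem_iff k (h.le_ker hk)).1 hk
  · rw [hR, map_one, eq_comm, QuotientGroup.eq_one_iff]

end IsChiefLift

/-- Condition (a) gives an injective choice of lifts. -/
theorem exists_chiefLifts (hτ : Function.Surjective τ) (hτ' : Function.Surjective τ')
    (hπ : Function.Surjective π)
    (ha : ∀ (E : Type u) [Group E] [TopologicalSpace E] [IsTopologicalGroup E]
          [CompactSpace E] [TotallyDisconnectedSpace E] (ζ : E →ₜ* G'),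
        IsIndecomposable ζ → HasNonabelianKernel ζ →
          coverMult τ' ζ ≤ coverMult τ (inflCover π ζ)) :
    ∃ M : NonabelianChief τ' → Subgroup H, Function.Injective M ∧
      ∀ N, ∃ f, IsChiefLift π τ N (M N) f := by
  have hg : ∀ c : NonabelianChief τ', ∃ g : Subgroup H' → Subgroup H,
      Set.MapsTo g (coverQuotients τ' (chiefCover c))
        (coverQuotients τ (inflCover π (chiefCover c))) ∧
      Set.InjOn g (coverQuotients τ' (chiefCover c)) := by
    intro c
    have := ha _ (chiefCover c) (isIndecomposable_chiefCover hτ' c)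
      (hasNonabelianKernel_chiefCover c)
    obtain ⟨e⟩ := Cardinal.le_def _ _ |>.1 this
    classical
    refine ⟨fun N => if h : N ∈ coverQuotients τ' (chiefCover c) then (e ⟨N, h⟩).1 else ⊥,
      fun N hN => ?_, fun N hN N₂ hN₂ h => ?_⟩
    · beta_reduce; rw [dif_pos hN]; exact (e _).2
    · simp only [dif_pos hN, dif_pos hN₂] at h
      exact congrArg Subtype.val (e.injective (Subtype.ext h))
  choose g hgm hgi using hg
  -- The injection `g c` depends on the cover `c` and not just on its class, so one representative
  -- is fixed per isomorphism class and its injection is used throughout the class.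
  let r : Setoid (NonabelianChief τ') :=
    { r := fun N N₂ => CoverIso (chiefCover N) (chiefCover N₂)
      iseqv := ⟨fun _ => CoverIso.refl _, fun h => h.symm, fun h h' => h.trans h'⟩ }
  let rep : NonabelianChief τ' → NonabelianChief τ' := fun N => (Quotient.mk r N).out
  have hrep : ∀ N, CoverIso (chiefCover N) (chiefCover (rep N)) := fun N =>
    (Quotient.mk_out (s := r) N).symm
  have hmem : ∀ N, N.1 ∈ coverQuotients τ' (chiefCover (rep N)) := fun N =>
    ⟨inferInstance, N.2.1.lt.le, N.2.1.isClosed, hrep N⟩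
  have hlift : ∀ N, ∃ f, IsChiefLift π τ N (g (rep N) N.1) f := by
    intro N
    have hM := hgm (rep N) (hmem N)
    obtain ⟨f, hf1, hf2, hf3⟩ := exists_hom_of_mem_coverQuotients hM
    obtain ⟨e, he⟩ := (hrep N).symm
    obtain ⟨_, hMK, _⟩ := hM
    refine ⟨{ toMonoidHom := e.toMulEquiv.toMonoidHom.comp f.toMonoidHom
              continuous_toFun := e.continuous_toFun.comp f.continuous_toFun },
      fun h => (he (f h)).trans (hf1 h), fun q hq => ?_, hMK, fun k hk => ?_⟩
    · obtain ⟨k, hk, hkq⟩ := hf2 (e.symm q) (by rw [← he, e.apply_symm_apply, hq])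
      refine ⟨k, hk, ?_⟩
      change e (f k) = q
      rw [hkq, e.apply_symm_apply]
    · rw [hf3 k hk]
      exact (map_eq_one_iff e e.injective).symm
  refine ⟨fun N => g (rep N) N.1, fun N N₂ h => ?_, hlift⟩
  obtain ⟨f, hf⟩ := hlift N
  obtain ⟨f₂, hf₂⟩ := hlift N₂
  have h : g (rep N) N.1 = g (rep N₂) N₂.1 := h
  rw [← h] at hf₂
  -- A common `M` forces isomorphic covers, hence the same representative; then injectivity within
  -- the class finishes.
  have hiso := hf.coverIso hτ hπ hf₂
  have hrr : rep N = rep N₂ := congrArg Quotient.out (Quotient.sound (s := r) hiso)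
  rw [hrr] at h
  exact Subtype.ext (hgi (rep N₂) (hrr ▸ hmem N) (hmem N₂) h)

end Chief

/-! ### Representatives of finite simple modules, and bases. -/

section Modules

/-- A finite simple module over `G`. -/
structure FiniteSimpleModule (G : Type u) [Group G] [TopologicalSpace G] : Type (u + 1) where
  carrier : Type u
  [addCommGroup : AddCommGroup carrier]
  rep : Representation ℤ G carrier
  isFiniteSimple : IsFiniteSimple rep

attribute [instance] FiniteSimpleModule.addCommGroup

variable {G : Type u} [Group G] [TopologicalSpace G]

/-- Isomorphism of finite simple modules. -/
instance finiteSimpleModuleSetoid (G : Type u) [Group G] [TopologicalSpace G] :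
    Setoid (FiniteSimpleModule G) where
  r A B := ∃ e : A.carrier ≃+ B.carrier, ∀ g a, e (A.rep g a) = B.rep g (e a)
  iseqv := {
    refl := fun A => ⟨AddEquiv.refl _, fun _ _ => rfl⟩
    symm := fun {A B} ⟨e, he⟩ => ⟨e.symm, fun g b => by
      rw [AddEquiv.symm_apply_eq, he, e.apply_symm_apply]⟩
    trans := fun {A B D} ⟨e, he⟩ ⟨e', he'⟩ => ⟨e.trans e', fun g a =>
      (congrArg e' (he g a)).trans (he' g _)⟩ }

lemma exists_spanning_linearIndependent {R V : Type u} [Ring R] [Nontrivial R] [AddCommGroup V]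
    [Module R V] (hR : ∀ a : R, IsUnit a ∨ a = 0) :
    ∃ (B : Type u) (b : B → V), LinearIndependent R b ∧ Submodule.span R (Set.range b) = ⊤ := by
  let := DivisionRing.ofIsUnitOrEqZero hR
  let b := Module.Basis.ofVectorSpace R V
  exact ⟨_, b, b.linearIndependent, b.span_eq⟩

end Modules

/-! ### Sufficiency and the main theorem. -/

section Main

variable {H G H' G' : Type u}
    [Group H] [TopologicalSpace H] [IsTopologicalGroup H]
    [CompactSpace H] [TotallyDisconnectedSpace H]
    [Group G] [TopologicalSpace G] [IsTopologicalGroup G]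
    [CompactSpace G] [TotallyDisconnectedSpace G]
    [Group H'] [TopologicalSpace H'] [IsTopologicalGroup H']
    [CompactSpace H'] [TotallyDisconnectedSpace H']
    [Group G'] [TopologicalSpace G'] [IsTopologicalGroup G']
    [CompactSpace G'] [TotallyDisconnectedSpace G']
    {τ : H →ₜ* G} {τ' : H' →ₜ* G'} {π : G →ₜ* G'}

/-- An element of `Ker τ` is detected by the non-abelian chief quotients and by homomorphisms to
finite simple modules, if `τ` is fundamental. -/
lemma IsFundamental.eq_one (hfund : IsFundamental τ) (hτ : Function.Surjective τ)
    {k : H} (hk : k ∈ τ.toMonoidHom.ker) (hna : ∀ N : NonabelianChief τ, k ∈ N.1)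
    (hab : ∀ (c : Quotient (finiteSimpleModuleSetoid G)) (φ : kerDual τ c.out.rep),
      φ.1 ⟨k, hk⟩ = 0) : k = 1 := by
  rw [← Subgroup.mem_bot, ← hfund]
  refine ⟨hk, Subgroup.mem_sInf.2 fun N hN => ?_⟩
  by_cases h : ∃ x ∈ τ.toMonoidHom.ker, ∃ y ∈ τ.toMonoidHom.ker, ⁅x, y⁆ ∉ N
  · exact hna ⟨N, hN, h⟩
  · push Not at h
    obtain ⟨A, _, ρ, φ, hρ, rfl⟩ := exists_dualKernel_eq τ hτ hN h
    obtain ⟨e, he⟩ := Setoid.symm (Quotient.mk_out (s := finiteSimpleModuleSetoid G) ⟨A, ρ, hρ⟩)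
    have he : ∀ g (a : A), e (ρ g a) = _ := he
    have h0 := hab _ ⟨fun x => e (φ.1 x), φ.2.1.comp e,
      fun x y => (congrArg e (kerDual_mul φ x y)).trans (map_add e _ _),
      fun g x => (congrArg e (kerDual_conj φ g x)).trans (he _ _)⟩
    exact ⟨hk, (map_eq_zero_iff e e.injective).1 h0⟩

/-- Conditions (a), (b), (c) are sufficient. -/
theorem exists_semiCartesian (hτ : Function.Surjective τ) (hτ' : Function.Surjective τ')
    (hfund : IsFundamental τ') (hπ : Function.Surjective π)
    (ha : ∀ (E : Type u) [Group E] [TopologicalSpace E] [IsTopologicalGroup E]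
          [CompactSpace E] [TotallyDisconnectedSpace E] (ζ : E →ₜ* G'),
        IsIndecomposable ζ → HasNonabelianKernel ζ →
          coverMult τ' ζ ≤ coverMult τ (inflCover π ζ))
    (hb : ∀ (A : Type u) [AddCommGroup A] (ρ : Representation ℤ G' A), IsFiniteSimple ρ →
        inflH2 π ρ '' (moduleSupp τ' hτ' ρ : Set (H2 ρ)) ⊆
          (moduleSupp τ hτ (inflModule π ρ) : Set (H2 (inflModule π ρ))))
    (hc : ∀ (A : Type u) [AddCommGroup A] (ρ : Representation ℤ G' A), IsFiniteSimple ρ →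
        inflNullity π τ' hτ' ρ + moduleMult τ' hτ' ρ ≤
          moduleMult τ hτ (inflModule π ρ)) :
    ∃ θ : H →ₜ* H', IsSemiCartesian θ τ τ' π := by
  obtain ⟨Mna, hMinj, hlift⟩ := exists_chiefLifts hτ hτ' hπ ha
  choose f hf using hlift
  let C := Quotient (finiteSimpleModuleSetoid G')
  let ρ : ∀ c : C, Representation ℤ G' c.out.carrier := fun c => c.out.rep
  have hρ : ∀ c, IsFiniteSimple (ρ c) := fun c => c.out.isFiniteSimple
  have hne : ∀ (c c' : C) (f : c.out.carrier →+ c'.out.carrier),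
      (∀ g a, f (ρ c g a) = ρ c' g (f a)) → f ≠ 0 → c = c' := by
    intro c c' f hf hf0
    have hbij := ((hρ c).bijective_or_eq_zero (hρ c') f hf).resolve_right hf0
    exact Quotient.out_equiv_out.1 ⟨AddEquiv.ofBijective f hbij, hf⟩
  have hbasis : ∀ c, ∃ (B : Type u) (b : B → kerDual τ' (ρ c)),
      LinearIndependent (EndRing (ρ c)) b ∧
        Submodule.span (EndRing (ρ c)) (Set.range b) = ⊤ := fun c => by
    have := (hρ c).nontrivial_endRing
    exact exists_spanning_linearIndependent (hρ c).isUnit_or_eq_zero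
  choose B b hbli hbspan using hbasis
  choose l hl hlS using fun c : C => exists_injective_kerDual hτ hτ' hπ (hρ c)
    (hb _ (ρ c) (hρ c)) (hc _ (ρ c) (hρ c))
  -- An injective semilinear map over a bijection of scalars preserves linear independence; this
  -- gives independence on the `H` side.
  have hlli : ∀ c, LinearIndependent (EndRing (inflModule π (ρ c))) fun x => l c (b c x) := by
    intro c
    obtain ⟨e, -, he⟩ := Function.bijective_iff_has_inverse.1 (endIncl_bijective π hπ (ρ c))
    have hsmul : ∀ (r : EndRing (inflModule π (ρ c))) m, l c (e r • m) = r • l c m := fun r m => by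
      rw [LinearMap.map_smulₛₗ, he]
    refine (hbli c).map_of_injective_injective e (l c).toAddMonoidHom (fun r hr => ?_)
      (fun m hm => ?_) hsmul
    · rw [← he r, hr, map_zero]
    · exact (map_eq_zero_iff (l c) (hl c)).1 hm
  let φ : ∀ i : Σ c, B c, kerDual τ' (ρ i.1) := fun i => b i.1 i.2
  let ψ : ∀ i : Σ c, B c, kerDual τ (inflModule π (ρ i.1)) := fun i => l i.1 (φ i)
  have hφ0 : ∀ i, φ i ≠ 0 := fun i => by
    have := (hρ i.1).nontrivial_endRing
    exact (hbli i.1).ne_zero i.2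
  have hψ0 : ∀ i, ψ i ≠ 0 := fun i h => hφ0 i (hl i.1 (by rw [map_zero]; exact h))
  have hinf : ∀ c, IsFiniteSimple (inflModule π (ρ c)) := fun c => (hρ c).inflModule π hπ
  have hrel : ∀ i : NonabelianChief τ' ⊕ Σ c, B c,
      ∃ R : Subgroup (H × H'), IsClosed (R : Set (H × H')) ∧
      (∀ p ∈ R, τ' p.2 = π (τ p.1)) ∧ (∀ h, ∃ h', (h, h') ∈ R) ∧
      (∀ k' ∈ τ'.toMonoidHom.ker, ∃ k ∈ τ.toMonoidHom.ker, (k, k') ∈ R) ∧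
      (∀ k ∈ Sum.elim Mna (fun i => dualKernel (ψ i)) i, (k, 1) ∈ R) ∧
      ∀ h', (1, h') ∈ R ↔
        h' ∈ Sum.elim (fun N : NonabelianChief τ' => N.1) (fun i => dualKernel (φ i)) i := by
    rintro (N | i)
    · exact (hf N).exists_relation
    · exact exists_relation_of_kerDual _ _ (φ i) (ψ i)
        (kerDual_surjective hτ' (hρ i.1) (hφ0 i)) (kerDual_surjective hτ (hinf i.1) (hψ0 i))
        (hlS i.1 (φ i))
  choose R hRc hRπ hR hR' hRM hRN using hrel
  refine exists_semiCartesian_of_relations τ τ' hτ' π R _ _ hRc hRπ hR hR' hRM hRN ?_ ?_ ?_ ?_ ?_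
  · rintro (N | i)
    · exact ((hf N).isMaximalNormalIn hτ hπ).isClosed
    · exact isClosed_dualKernel (ψ i)
  · rintro (N | i)
    · exact N.2.1.isClosed
    · exact isClosed_dualKernel (φ i)
  · exact independentIn_sumElim hτ hinf (fun c c' f hf hf0 => hne c c' f (fun g a => by
      obtain ⟨x, rfl⟩ := hπ g
      exact hf x a) hf0) ψ hlli Mna (fun N => (hf N).isMaximalNormalIn hτ hπ) hMinj
      fun N => (hf N).exists_commutator_notMem
  · exact independentIn_sumElim hτ' hρ hne φ hbli _ (fun N => N.2.1) Subtype.val_injective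
      fun N => N.2.2
  · intro k hk hki
    refine hfund.eq_one hτ' hk (fun N => hki (Sum.inl N)) fun c χ => ?_
    -- Vanishing at `k` is a linear condition, so it passes from the basis to all equivariant
    -- homomorphisms.
    let S : Submodule (EndRing (ρ c)) (kerDual τ' (ρ c)) :=
      { carrier := {χ | χ.1 ⟨k, hk⟩ = 0}
        zero_mem' := rfl
        add_mem' := fun {χ χ'} h h' => by
          change χ.1 ⟨k, hk⟩ + χ'.1 ⟨k, hk⟩ = 0
          rw [show χ.1 ⟨k, hk⟩ = 0 from h, show χ'.1 ⟨k, hk⟩ = 0 from h', add_zero]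
        smul_mem' := fun α χ h => by
          change α • χ.1 ⟨k, hk⟩ = 0
          rw [show χ.1 ⟨k, hk⟩ = 0 from h, smul_zero] }
    have hS : Submodule.span (EndRing (ρ c)) (Set.range (b c)) ≤ S := by
      rw [Submodule.span_le]
      rintro _ ⟨x, rfl⟩
      exact (mem_dualKernel ⟨k, hk⟩).1 (hki (Sum.inr ⟨c, x⟩))
    rw [hbspan] at hS
    exact hS (Submodule.mem_top (x := χ))

end Main

end ProfiniteCover

theorem mainTheorem7 {H G H' G' : Type u}
    [Group H] [TopologicalSpace H] [IsTopologicalGroup H]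
    [CompactSpace H] [TotallyDisconnectedSpace H]
    [Group G] [TopologicalSpace G] [IsTopologicalGroup G]
    [CompactSpace G] [TotallyDisconnectedSpace G]
    [Group H'] [TopologicalSpace H'] [IsTopologicalGroup H']
    [CompactSpace H'] [TotallyDisconnectedSpace H']
    [Group G'] [TopologicalSpace G'] [IsTopologicalGroup G']
    [CompactSpace G'] [TotallyDisconnectedSpace G']
    (τ : H →ₜ* G) (hτ : Function.Surjective τ) (hτfund : IsFundamental τ)
    (τ' : H' →ₜ* G') (hτ' : Function.Surjective τ') (hτ'fund : IsFundamental τ')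
    (π : G →ₜ* G') (hπ : Function.Surjective π) :
    (∃ θ : H →ₜ* H', Function.Surjective θ ∧ IsSemiCartesian θ τ τ' π) ↔
      (∀ (E : Type u) [Group E] [TopologicalSpace E] [IsTopologicalGroup E]
          [CompactSpace E] [TotallyDisconnectedSpace E] (ζ : E →ₜ* G'),
        IsIndecomposable ζ → HasNonabelianKernel ζ →
          coverMult τ' ζ ≤ coverMult τ (inflCover π ζ)) ∧
      (∀ (A : Type u) [AddCommGroup A] (ρ : Representation ℤ G' A), IsFiniteSimple ρ →
        inflH2 π ρ '' (moduleSupp τ' hτ' ρ : Set (H2 ρ)) ⊆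
          (moduleSupp τ hτ (inflModule π ρ) : Set (H2 (inflModule π ρ)))) ∧
      (∀ (A : Type u) [AddCommGroup A] (ρ : Representation ℤ G' A), IsFiniteSimple ρ →
        inflNullity π τ' hτ' ρ + moduleMult τ' hτ' ρ ≤
          moduleMult τ hτ (inflModule π ρ)) := by
  constructor
  · rintro ⟨θ, -, h⟩
    refine ⟨?_, ?_, ?_⟩
    · intro E _ _ _ _ _ ζ _ _
      exact h.coverMult_le hτ ζ
    · intro A _ ρ hρ
      exact h.inflH2_moduleSupp_subset hτ hτ' hπ hρ
    · intro A _ ρ hρ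
      exact h.inflNullity_add_moduleMult_le hτ hτ' hπ hρ
  · rintro ⟨ha, hb, hc⟩
    obtain ⟨θ, hθ⟩ := exists_semiCartesian hτ hτ' hτ'fund hπ ha hb hc
    exact ⟨θ, hθ.surjective hτ hπ, hθ⟩
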